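/- Definitions. A \emph{game} $A$ consists of a set $M_A$ of moves, a labelling $\lambda_A:M_A\to\{O,P\}$, a starting player $b_A$, a nonempty prefix-closed set $P_A$ of finite sequences of moves (\emph{plays}) that start with a $b_A$-move (if nonempty) and alternate between $O$-moves and $P$-moves, and a set $W_A$ of infinite plays won by Player. $A$ is \emph{negative} if $b_A=O$. A \emph{strategy} on a negative game $A$ is a nonempty set $\sigma\subseteq P_A$ such that every nonempty play in $\sigma$ ends with a $P$-move; $sab\in\sigma$ implies $s\in\sigma$; and $sa,sb\in\sigma$ implies $a=b$. For negative games $M,N$: the plays of the negative game $N\oslash M$ are the alternating interleavings of a play of $N$ and a play of $M$ whose first move, if any, is in $N$; the plays of the negative game $M\multimap N$ are the interleavings of a play of $N$ and a play of $M$, starting in $N$, that alternate when the labels of the moves of $M$ are swapped; the plays of the negative game ${!}N$ are the alternating interleavings of plays in copies of $N$ indexed by $0,1,2,\dots$ such that any move in copy $i+1$ is preceded by a move in copy $i$. (The sets of infinite winning plays of these games play no role for strategies: an infinite play of $N\oslash M$ or of ${!}N$ is won by Player iff its restriction to each component is, one of $M\multimap N$ iff its restriction to $N$ is won by Player or its restriction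 to $M$ is not; a finite restriction is won by Player iff it is empty or ends with a $P$-move.) The category $\mathcal G$ has negative games as objects; a map $A\to B$ is a strategy on $A\multimap B$. The composite of $\sigma:A\to B$ and $\tau:B\to C$ is the set of the restrictions to $A,C$ of those finite sequences $s$ of moves of $A$, $B$, $C$ whose restriction to $A,B$ is in $\sigma$ and whose restriction to $B,C$ is in $\tau$; the identity on $A$ is the copycat strategy, i.e. the set of even-length plays of $A\multimap A$ all of whose even-length prefixes have equal restrictions to the two copies of $A$. Maps $A\to B$ are ordered by inclusion; the least one is $\epsilon=\{\varepsilon\}$, the strategy that contains only the empty play. For a negative game $N$ the functor $N\oslash\_:\mathcal G\to\mathcal G$ sends $\gamma:M\to M'$ to the strategy $\mathrm{id}\oslash\gamma$ of all plays of $(N\oslash M)\multimap(N\oslash M')$ whose restriction to the two copies of $N$ is in $\mathrm{id}_N$ and whose restriction to $M,M'$ is in $\gamma$. Let $\alpha:{!}N\to N\oslash{!}N$ be the copycat strategy that identifies a move $a$ of the left component $N$ with the move $a$ in copy $0$ of ${!}N$, and a move $a$ in copy $n$ of the right component ${!}N$ with the move $a$ in copy $n+1$ of ${!}N$. \textbf{Proposition.}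 For every negative game $N$, $({!}N,\alpha)$ is a final coalgebra of the functor $N\oslash\_$ on the category $\mathcal G$: for every negative game $M$ and every map $\sigma:M\to N\oslash M$ there is exactly one map $(\!|\sigma|\!):M\to{!}N$ with $\alpha\circ(\!|\sigma|\!)=(\mathrm{id}\oslash(\!|\sigma|\!))\circ\sigma$. In particular $\alpha$ is an isomorphism. Moreover, put $\sigma_0=\mathrm{id}_M$, $\sigma_{k+1}=(\mathrm{id}\oslash\_)^k(\sigma)\circ\sigma_k:M\to(N\oslash\_)^{k+1}(M)$, and let $\alpha_k:{!}N\to(N\oslash\_)^k({!}N)$ be the isomorphisms obtained in the same way from $\alpha$. Then the maps $$s_k=\alpha_k^{-1}\circ(\mathrm{id}\oslash\_)^k(\epsilon)\circ\sigma_k:M\to{!}N\qquad(k\ge 0),$$ with $\epsilon:M\to{!}N$, form an increasing chain, and $(\!|\sigma|\!)$ is its least upper bound in the set of maps $M\to{!}N$ ordered by inclusion. -/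

import Mathlib

open CategoryTheory

universe u

namespace GameSem

/-- The two protagonists, Opponent and Player. -/
inductive Player : Type
  | O : Player
  | P : Player

/-- Swapping the protagonists. -/
def Player.neg : Player → Player
  | .O => .P
  | .P => .O

/-- `Alternating l b s`: the finite sequence `s` starts with a `b`-move (if it is nonempty) and
alternates between O-moves and P-moves, `l` being the labelling. -/
def Alternating {X : Type u} (l : X → Player) : Player → List X → Prop
  | _, [] => True
  | b, x :: s => l x = b ∧ Alternating l b.neg s

/-- The prefix of length `n` of an infinite sequence. -/
def initSeg {X : Type u} (s : ℕ → X) (n : ℕ) : List X := (List.range n).map s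

/-- The infinite sequences all of whose finite prefixes lie in `T`. -/
def infClosure {X : Type u} (T : Set (List X)) : Set (ℕ → X) := {s | ∀ n, initSeg s n ∈ T}

/-- A game: moves, their labelling, the starting player, a nonempty prefix-closed set of
alternating finite sequences (the plays), and a set of infinite plays (those won by Player). -/
structure Game : Type (u + 1) where
  M : Type u
  lab : M → Player
  start : Player
  plays : Set (List M)
  alternating : ∀ s ∈ plays, Alternating lab start s
  nil_mem : [] ∈ plays
  prefix_closed : ∀ s ∈ plays, ∀ t, t <+: s → t ∈ plays
  win : Set (ℕ → M)
  win_subset : win ⊆ infClosure plays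

/-- A negative game: Opponent starts. -/
structure NegGame : Type (u + 1) extends Game.{u} where
  start_eq : start = Player.O

/-- The finite plays that count as won by Player: those ending with a P-move, and the empty play
if it is Opponent who has to start. -/
def Game.finWin (A : Game.{u}) : Set (List A.M) :=
  {s | s ∈ A.plays ∧ ((s = [] ∧ A.start = Player.O) ∨ ∃ t m, s = t ++ [m] ∧ A.lab m = Player.P)}

/-- `A.WinsOn f s`: the (finite or infinite) sequence obtained from the infinite sequence `s` by
applying the partial map `f` to its entries, dropping those on which `f` is undefined, is won by
Player in `A`. -/
def Game.WinsOn (A : Game.{u}) {X : Type u} (f : X → Option A.M) (s : ℕ → X) : Prop :=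
  (∃ w ∈ A.win, ∀ n, ∃ k, initSeg w n <+: (initSeg s k).filterMap f) ∨
  (∃ w ∈ A.finWin, ∃ k, ∀ j, k ≤ j → (initSeg s j).filterMap f = w)

theorem Player.neg_neg (b : Player) : b.neg.neg = b := by cases b <;> rfl

theorem alternating_neg {X : Type u} (l : X → Player) (s : List X) (b : Player)
    (h : Alternating l b s) : Alternating (fun x => (l x).neg) b.neg s := by
  induction s generalizing b with
  | nil => trivial
  | cons x s ih => exact ⟨congrArg Player.neg h.1, ih _ h.2⟩

/-- Negation of a game. -/
def Game.neg (A : Game.{u}) : Game.{u} where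
  M := A.M
  lab := fun m => (A.lab m).neg
  start := A.start.neg
  plays := A.plays
  alternating := fun s hs => alternating_neg _ _ _ (A.alternating s hs)
  nil_mem := A.nil_mem
  prefix_closed := A.prefix_closed
  win := infClosure A.plays \ A.win
  win_subset := Set.sdiff_subset

/-- The player to move after `n` moves if `b` starts. -/
def turn (b : Player) (n : ℕ) : Player := if n % 2 = 0 then b else b.neg

theorem alternating_snoc {X : Type u} (l : X → Player) (s : List X) (x : X) (b : Player) :
    Alternating l b (s ++ [x]) ↔ Alternating l b s ∧ l x = turn b s.length := by
  induction s generalizing b with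
  | nil => simp [Alternating, turn]
  | cons y s ih =>
    have : turn b.neg s.length = turn b (y :: s).length := by
      simp only [turn, List.length_cons]
      rcases Nat.mod_two_eq_zero_or_one s.length with h | h
      · rw [if_pos h, if_neg (by omega)]
      · rw [if_neg (by omega), if_pos (by omega), Player.neg_neg]
    simp only [List.cons_append, Alternating, ih, this, and_assoc]

theorem alternating_append {X : Type u} (l : X → Player) (s t : List X) (b : Player)
    (h : Alternating l b (s ++ t)) : Alternating l b s := by
  induction s generalizing b with
  | nil => trivial
  | cons y s ih => exact ⟨h.1, ih _ h.2⟩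

theorem alternating_prefix {X : Type u} {l : X → Player} {s t : List X} {b : Player}
    (h : Alternating l b s) (ht : t <+: s) : Alternating l b t := by
  obtain ⟨r, rfl⟩ := ht
  exact alternating_append l t r b h

/-- The plays of `A ⊘ N`. -/
def Game.seqPlays (A : Game.{u}) (N : NegGame.{u}) : Set (List (A.M ⊕ N.M)) :=
  {s | Alternating (Sum.elim A.lab N.lab) A.start s ∧
    s.filterMap Sum.getLeft? ∈ A.plays ∧ s.filterMap Sum.getRight? ∈ N.plays ∧
    ∀ t, t <+: s → t.filterMap Sum.getLeft? = [] → t.filterMap Sum.getRight? = []}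

/-- The left merge (sequoid) `A ⊘ N`: interleavings of a play in `A` with a play in `N`, whose
first move, if any, is in `A`. An infinite play is won by Player if both restrictions are. -/
def Game.seq (A : Game.{u}) (N : NegGame.{u}) : Game.{u} where
  M := A.M ⊕ N.M
  lab := Sum.elim A.lab N.lab
  start := A.start
  plays := A.seqPlays N
  alternating := fun _ hs => hs.1
  nil_mem := ⟨trivial, A.nil_mem, N.nil_mem, by
    intro t ht _; rw [List.prefix_nil.1 ht]; rfl⟩
  prefix_closed := fun s hs t ht =>
    ⟨alternating_prefix hs.1 ht, A.prefix_closed _ hs.2.1 _ (ht.filterMap _),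
      N.prefix_closed _ hs.2.2.1 _ (ht.filterMap _), fun r hr => hs.2.2.2 r (hr.trans ht)⟩
  win := {s | s ∈ infClosure (A.seqPlays N) ∧
    A.WinsOn Sum.getLeft? s ∧ N.toGame.WinsOn Sum.getRight? s}
  win_subset := fun _ hs => hs.1

/-- The sequoid of two negative games is negative. -/
def NegGame.seq (N M : NegGame.{u}) : NegGame.{u} where
  toGame := N.toGame.seq M
  start_eq := N.start_eq

/-- Affine implication `A ⊸ B = B ◁ A^⊥ = (B^⊥ ⊘ A)^⊥`. A move `Sum.inl m` is played in the
target `B`, a move `Sum.inr m` is played in the source `A`. -/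
def NegGame.lolli (A B : NegGame.{u}) : NegGame.{u} where
  toGame := (B.toGame.neg.seq A).neg
  start_eq := by
    change B.start.neg.neg = Player.O
    rw [Player.neg_neg, B.start_eq]

/-- The partial map that keeps the moves of the `i`-th copy. -/
def copy {X : Type u} (i : ℕ) (x : X × ℕ) : Option X :=
  if x.2 = i then some x.1 else none

/-- The plays of `!N`. -/
def NegGame.bangPlays (N : NegGame.{u}) : Set (List (N.M × ℕ)) :=
  {s | Alternating (fun x => N.lab x.1) Player.O s ∧
    (∀ i, s.filterMap (copy i) ∈ N.plays) ∧
    ∀ t, t <+: s → ∀ i, t.filterMap (copy i) = [] → t.filterMap (copy (i + 1)) = []}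

/-- The exponential `!N`: alternating interleavings of plays in copies of `N` indexed by `ℕ`,
in which any move in copy `i + 1` is preceded by a move in copy `i`. An infinite play is won by
Player if its restriction to each copy is. -/
def NegGame.bang (N : NegGame.{u}) : NegGame.{u} where
  M := N.M × ℕ
  lab := fun x => N.lab x.1
  start := Player.O
  plays := N.bangPlays
  alternating := fun _ hs => hs.1
  nil_mem := ⟨trivial, fun _ => N.nil_mem, by
    intro t ht _ _; rw [List.prefix_nil.1 ht]; rfl⟩
  prefix_closed := fun s hs t ht =>
    ⟨alternating_prefix hs.1 ht, fun i => N.prefix_closed _ (hs.2.1 i) _ (ht.filterMap _),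
      fun r hr => hs.2.2 r (hr.trans ht)⟩
  win := {s | s ∈ infClosure N.bangPlays ∧ ∀ i, N.toGame.WinsOn (copy i) s}
  win_subset := fun _ hs => hs.1
  start_eq := rfl

/-- The conditions for a set of plays to be a strategy on `A`. -/
structure IsStrategy (A : Game.{u}) (σ : Set (List A.M)) : Prop where
  subset : σ ⊆ A.plays
  last : ∀ s a, s ++ [a] ∈ σ → A.lab a = Player.P
  even_closed : ∀ s a b, s ++ [a, b] ∈ σ → s ∈ σ
  det : ∀ s a b, s ++ [a] ∈ σ → s ++ [b] ∈ σ → a = b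
  start_of_empty : σ = ∅ → A.start = Player.P
  start_of_nil_mem : [] ∈ σ → A.start = Player.O

/-- Strategies on `A`. -/
@[ext]
structure Strategy (A : Game.{u}) : Type u where
  traces : Set (List A.M)
  isStrategy : IsStrategy A traces

/-- Strategies are ordered by inclusion. -/
instance (A : Game.{u}) : PartialOrder (Strategy A) where
  le σ τ := σ.traces ⊆ τ.traces
  le_refl _ := Set.Subset.rfl
  le_trans _ _ _ h h' := Set.Subset.trans h h'
  le_antisymm _ _ h h' := Strategy.ext (Set.Subset.antisymm h h')

section Combinatorics

theorem filterMap_comp {X Y Z : Type*} {f : X → Option Y} {g : Y → Option Z} {h : X → Option Z}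
    (H : ∀ x, (f x).bind g = h x) (s : List X) :
    (s.filterMap f).filterMap g = s.filterMap h := by
  rw [List.filterMap_filterMap]
  congr 1
  funext x
  exact H x

theorem prefix_lift {X Y : Type*} {f : X → Option Y} {s : List X} {t : List Y}
    (h : t <+: s.filterMap f) : ∃ s', s' <+: s ∧ s'.filterMap f = t := by
  obtain ⟨l, h1, h2⟩ := List.prefix_filterMap_iff.1 h
  exact ⟨l, h1, h2.symm⟩

/-- Two sequences that agree on a common part can be interleaved along it. -/
theorem amalgam {X Y Z V : Type*} (f : X → Option Y) (g : X → Option Z) (f' : Y → Option V)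
    (g' : Z → Option V) (h1 : ∀ y, f' y = none → ∃ x, f x = some y ∧ g x = none)
    (h2 : ∀ z, g' z = none → ∃ x, g x = some z ∧ f x = none)
    (h3 : ∀ y z v, f' y = some v → g' z = some v → ∃ x, f x = some y ∧ g x = some z) :
    ∀ (s : List Y) (t : List Z), s.filterMap f' = t.filterMap g' →
      ∃ w : List X, w.filterMap f = s ∧ w.filterMap g = t := by
  intro s
  induction s with
  | nil =>
    intro t
    induction t with
    | nil => intro _; exact ⟨[], rfl, rfl⟩
    | cons z t ih =>
      intro h
      rcases hz : g' z with _ | v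
      · rw [List.filterMap_cons_none hz] at h
        obtain ⟨w, hw1, hw2⟩ := ih h
        obtain ⟨x, hx1, hx2⟩ := h2 z hz
        exact ⟨x :: w, by rw [List.filterMap_cons_none hx2, hw1],
          by rw [List.filterMap_cons_some hx1, hw2]⟩
      · rw [List.filterMap_cons_some hz] at h
        simp at h
  | cons y s ihs =>
    intro t
    rcases hy : f' y with _ | v
    · intro h
      rw [List.filterMap_cons_none hy] at h
      obtain ⟨w, hw1, hw2⟩ := ihs t h
      obtain ⟨x, hx1, hx2⟩ := h1 y hy
      exact ⟨x :: w, by rw [List.filterMap_cons_some hx1, hw1],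
        by rw [List.filterMap_cons_none hx2, hw2]⟩
    · induction t with
      | nil =>
        intro h
        rw [List.filterMap_cons_some hy] at h
        simp at h
      | cons z t ih =>
        intro h
        rcases hz : g' z with _ | v'
        · rw [List.filterMap_cons_none hz] at h
          obtain ⟨w, hw1, hw2⟩ := ih h
          obtain ⟨x, hx1, hx2⟩ := h2 z hz
          exact ⟨x :: w, by rw [List.filterMap_cons_none hx2, hw1],
            by rw [List.filterMap_cons_some hx1, hw2]⟩
        · rw [List.filterMap_cons_some hy, List.filterMap_cons_some hz] at h
          obtain ⟨rfl, h'⟩ := List.cons.inj h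
          obtain ⟨w, hw1, hw2⟩ := ihs t h'
          obtain ⟨x, hx1, hx2⟩ := h3 y z v hy hz
          exact ⟨x :: w, by rw [List.filterMap_cons_some hx1, hw1],
            by rw [List.filterMap_cons_some hx2, hw2]⟩

theorem length_sum {X Y : Type*} (s : List (X ⊕ Y)) :
    s.length = (s.filterMap Sum.getLeft?).length + (s.filterMap Sum.getRight?).length := by
  induction s with
  | nil => rfl
  | cons x s ih => rcases x with x | x <;> simp [List.filterMap_cons, ih] <;> omega

theorem prefix_snoc_cases {X : Type*} {s t : List X} {x : X} (h : t <+: s ++ [x]) :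
    t = s ++ [x] ∨ t <+: s := List.prefix_concat_iff.1 h

/-- The last move of a play of a negative game belongs to the player whose turn it is. -/
theorem NegGame.lab_eq (N : NegGame.{u}) {s : List N.M} {x : N.M} (h : s ++ [x] ∈ N.plays) :
    N.lab x = turn Player.O s.length := by
  have := ((alternating_snoc _ _ _ _).1 (N.alternating _ h)).2
  rwa [N.start_eq] at this

theorem turn_eq_O {n : ℕ} : turn Player.O n = Player.O ↔ n % 2 = 0 := by
  unfold turn; split_ifs with h <;> simp [h, Player.neg]

theorem turn_eq_P {n : ℕ} : turn Player.O n = Player.P ↔ n % 2 = 1 := by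
  unfold turn; split_ifs with h <;> simp [h, Player.neg]; omega

theorem turn_inj {n m : ℕ} (h : turn Player.O n = turn Player.O m) : n % 2 = m % 2 := by
  unfold turn at h; split_ifs at h <;> simp_all [Player.neg] 

theorem turn_congr {n m : ℕ} (h : n % 2 = m % 2) : turn Player.O n = turn Player.O m := by
  unfold turn; rw [h]

theorem turn_neg {n m : ℕ} (h : turn Player.O n = (turn Player.O m).neg) : n % 2 ≠ m % 2 := by
  unfold turn at h; split_ifs at h <;> simp_all [Player.neg] 

theorem turn_neg' {n m : ℕ} (h : n % 2 ≠ m % 2) : (turn Player.O n).neg = turn Player.O m := by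
  unfold turn; split_ifs <;> simp_all [Player.neg] 

end Combinatorics

section Plays

variable {A B C N M : NegGame.{u}}

theorem nil_or_snoc {X : Type*} (s : List X) : s = [] ∨ ∃ r x, s = r ++ [x] := by
  rcases List.eq_nil_or_concat s with h | ⟨r, x, h⟩
  · exact Or.inl h
  · exact Or.inr ⟨r, x, by rw [h, List.concat_eq_append]⟩

theorem fm_snoc {X Y : Type*} (f : X → Option Y) (s : List X) (x : X) :
    (s ++ [x]).filterMap f = s.filterMap f ++ (f x).toList := by
  rw [List.filterMap_append]
  cases h : f x <;> simp [h]

theorem lolli_iff {s : List (B.M ⊕ A.M)} : s ∈ (A.lolli B).plays ↔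
    Alternating (Sum.elim (fun b => (B.lab b).neg) A.lab) Player.P s ∧
    s.filterMap Sum.getLeft? ∈ B.plays ∧ s.filterMap Sum.getRight? ∈ A.plays ∧
    ∀ t, t <+: s → t.filterMap Sum.getLeft? = [] → t.filterMap Sum.getRight? = [] := by
  have h : B.toGame.neg.start = Player.P := by
    change B.start.neg = _
    rw [B.start_eq]; rfl
  change s ∈ B.toGame.neg.seqPlays A ↔ _
  unfold Game.seqPlays
  rw [h]
  exact Iff.rfl

theorem seq_iff {s : List (N.M ⊕ M.M)} : s ∈ (N.seq M).plays ↔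
    Alternating (Sum.elim N.lab M.lab) Player.O s ∧
    s.filterMap Sum.getLeft? ∈ N.plays ∧ s.filterMap Sum.getRight? ∈ M.plays ∧
    ∀ t, t <+: s → t.filterMap Sum.getLeft? = [] → t.filterMap Sum.getRight? = [] := by
  change s ∈ N.toGame.seqPlays M ↔ _
  unfold Game.seqPlays
  rw [N.start_eq]
  exact Iff.rfl

theorem turn_P (n : ℕ) : turn Player.P n = (turn Player.O n).neg := by
  unfold turn; split_ifs <;> rfl

/-- Membership in the plays of `A ⊸ B`, with the alternation condition replaced by a condition on
the parities of the numbers of moves in the two components. -/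
theorem mem_lolli {s : List (B.M ⊕ A.M)} : s ∈ (A.lolli B).plays ↔
    s.filterMap Sum.getLeft? ∈ B.plays ∧ s.filterMap Sum.getRight? ∈ A.plays ∧
    ∀ t, t <+: s →
      (t.filterMap Sum.getRight?).length % 2 ≤ (t.filterMap Sum.getLeft?).length % 2 := by
  constructor
  · intro hs
    have hs' := lolli_iff.1 hs
    refine ⟨hs'.2.1, hs'.2.2.1, ?_⟩
    intro t ht
    have htp := lolli_iff.1 ((A.lolli B).prefix_closed s hs t ht)
    rcases nil_or_snoc t with rfl | ⟨r, x, rfl⟩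
    · exact le_rfl
    · obtain ⟨h1, h2, h3, -⟩ := htp
      have h4 := ((alternating_snoc _ _ _ _).1 h1).2
      have hl := length_sum r
      rw [turn_P] at h4
      rw [fm_snoc] at h2 h3
      rw [fm_snoc, fm_snoc]
      rcases x with b | a
      · have h5 := B.lab_eq h2
        have h6 : (B.lab b).neg = (turn Player.O r.length).neg := h4
        have h7 : B.lab b = turn Player.O r.length := by
          rw [← Player.neg_neg (B.lab b), h6, Player.neg_neg]
        rw [h7] at h5
        have := turn_inj h5
        simp only [Sum.getLeft?_inl, Sum.getRight?_inl, Option.toList, List.append_nil,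
          List.length_append, List.length_singleton]
        omega
      · have h5 := A.lab_eq h3
        have h6 : A.lab a = (turn Player.O r.length).neg := h4
        rw [h5] at h6
        have := turn_neg h6
        simp only [Sum.getLeft?_inr, Sum.getRight?_inr, Option.toList, List.append_nil,
          List.length_append, List.length_singleton]
        omega
  · rintro ⟨h1, h2, h3⟩
    refine lolli_iff.2 ⟨?_, h1, h2, ?_⟩
    · induction s using List.reverseRecOn with
      | nil => trivial
      | append_singleton r x ih =>
        rw [alternating_snoc]
        have hpre : r <+: r ++ [x] := List.prefix_append _ _
        refine ⟨ih (B.prefix_closed _ h1 _ (hpre.filterMap _))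
          (A.prefix_closed _ h2 _ (hpre.filterMap _)) (fun t ht => h3 t (ht.trans hpre)), ?_⟩
        rw [turn_P]
        have hl := length_sum r
        have h4 := h3 r hpre
        have h5 := h3 _ List.prefix_rfl
        rw [fm_snoc] at h1 h2
        rw [fm_snoc, fm_snoc] at h5
        rcases x with b | a
        · simp only [Sum.getLeft?_inl, Sum.getRight?_inl, Option.toList, List.append_nil,
            List.length_append, List.length_singleton] at h5
          change (B.lab b).neg = _
          rw [B.lab_eq h1]
          exact congrArg Player.neg (turn_congr (by omega))
        · simp only [Sum.getLeft?_inr, Sum.getRight?_inr, Option.toList, List.append_nil,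
            List.length_append, List.length_singleton] at h5
          change A.lab a = _
          rw [A.lab_eq h2]
          exact (turn_neg' (by omega)).symm
    · intro t ht h
      by_contra hne
      obtain ⟨a, l, hal⟩ := List.exists_cons_of_ne_nil hne
      obtain ⟨t', ht', e⟩ := prefix_lift (f := Sum.getRight?) (s := t) (t := [a])
        (by rw [hal]; exact ⟨l, rfl⟩)
      have h4 := h3 t' (ht'.trans ht)
      have h5 : t'.filterMap Sum.getLeft? = [] := by
        have := ht'.filterMap Sum.getLeft?
        rw [h] at this
        exact List.prefix_nil.1 this
      rw [e, h5] at h4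
      simp at h4

/-- The same for the plays of `N ⊘ M`. -/
theorem mem_seq {s : List (N.M ⊕ M.M)} : s ∈ (N.seq M).plays ↔
    s.filterMap Sum.getLeft? ∈ N.plays ∧ s.filterMap Sum.getRight? ∈ M.plays ∧
    ∀ t, t <+: s →
      (t.filterMap Sum.getLeft?).length % 2 + (t.filterMap Sum.getRight?).length % 2 ≤ 1 ∧
      (t.filterMap Sum.getLeft? = [] → t.filterMap Sum.getRight? = []) := by
  constructor
  · intro hs
    have hs' := seq_iff.1 hs
    refine ⟨hs'.2.1, hs'.2.2.1, fun t ht => ⟨?_, hs'.2.2.2 t ht⟩⟩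
    have htp := seq_iff.1 ((N.seq M).prefix_closed s hs t ht)
    rcases nil_or_snoc t with rfl | ⟨r, x, rfl⟩
    · exact Nat.zero_le _
    · obtain ⟨h1, h2, h3, -⟩ := htp
      have h4 := ((alternating_snoc _ _ _ _).1 h1).2
      have hl := length_sum r
      rw [fm_snoc] at h2 h3
      rw [fm_snoc, fm_snoc]
      rcases x with b | a
      · have h5 := N.lab_eq h2
        have h6 : N.lab b = _ := h4
        rw [h6] at h5
        have := turn_inj h5
        simp only [Sum.getLeft?_inl, Sum.getRight?_inl, Option.toList, List.append_nil,
          List.length_append, List.length_singleton]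
        omega
      · have h5 := M.lab_eq h3
        have h6 : M.lab a = _ := h4
        rw [h6] at h5
        have := turn_inj h5
        simp only [Sum.getLeft?_inr, Sum.getRight?_inr, Option.toList, List.append_nil,
          List.length_append, List.length_singleton]
        omega
  · rintro ⟨h1, h2, h3⟩
    refine seq_iff.2 ⟨?_, h1, h2, fun t ht => (h3 t ht).2⟩
    replace h3 := fun t ht => (h3 t ht).1
    induction s using List.reverseRecOn with
    | nil => trivial
    | append_singleton r x ih =>
      rw [alternating_snoc]
      have hpre : r <+: r ++ [x] := List.prefix_append _ _
      refine ⟨ih (N.prefix_closed _ h1 _ (hpre.filterMap _))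
        (M.prefix_closed _ h2 _ (hpre.filterMap _)) (fun t ht => h3 t (ht.trans hpre)), ?_⟩
      have hl := length_sum r
      have h4 := h3 r hpre
      have h5 := h3 _ List.prefix_rfl
      rw [fm_snoc] at h1 h2
      rw [fm_snoc, fm_snoc] at h5
      rcases x with b | a
      · simp only [Sum.getLeft?_inl, Sum.getRight?_inl, Option.toList, List.append_nil,
          List.length_append, List.length_singleton] at h5
        change N.lab b = _
        rw [N.lab_eq h1]
        exact turn_congr (by omega)
      · simp only [Sum.getLeft?_inr, Sum.getRight?_inr, Option.toList, List.append_nil,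
          List.length_append, List.length_singleton] at h5
        change M.lab a = _
        rw [M.lab_eq h2]
        exact turn_congr (by omega)

theorem IsStrategy.nil_mem {σ : Set (List N.M)} (h : IsStrategy N.toGame σ) : [] ∈ σ := by
  by_contra hn
  have hne : ∃ n : ℕ, ∃ s ∈ σ, s.length = n := by
    by_contra hh
    push Not at hh
    have := h.start_of_empty (Set.eq_empty_iff_forall_notMem.2 fun s hs => hh _ s hs rfl)
    rw [N.start_eq] at this
    cases this
  classical
  obtain ⟨s, hs, hl⟩ := Nat.find_spec hne
  rcases nil_or_snoc s with rfl | ⟨r, b, rfl⟩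
  · exact hn hs
  rcases nil_or_snoc r with rfl | ⟨q, a, rfl⟩
  · have h1 := h.last [] b hs
    have h2 := N.lab_eq (s := []) (x := b) (h.subset hs)
    rw [h1] at h2
    cases h2
  · have h1 : q ∈ σ := h.even_closed q a b (by simpa using hs)
    refine Nat.find_min hne (m := q.length) ?_ ⟨q, h1, rfl⟩
    rw [← hl]; simp

theorem IsStrategy.even {σ : Set (List N.M)} (h : IsStrategy N.toGame σ) {s : List N.M}
    (hs : s ∈ σ) : s.length % 2 = 0 := by
  rcases nil_or_snoc s with rfl | ⟨r, b, rfl⟩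
  · rfl
  · have h1 := h.last r b hs
    rw [N.lab_eq (h.subset hs), turn_eq_P] at h1
    simp; omega

theorem IsStrategy.prefix_mem {σ : Set (List N.M)} (h : IsStrategy N.toGame σ) :
    ∀ (n : ℕ) {s t : List N.M}, s ∈ σ → t <+: s → t.length % 2 = 0 → s.length ≤ n → t ∈ σ := by
  intro n
  induction n with
  | zero =>
    intro s t hs ht _ hl
    have : s = [] := List.length_eq_zero_iff.1 (by omega)
    subst this
    rw [List.prefix_nil.1 ht]; exact hs
  | succ n ih =>
    intro s t hs ht he hl
    have hes := h.even hs
    rcases nil_or_snoc s with rfl | ⟨r, b, rfl⟩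
    · rw [List.prefix_nil.1 ht]; exact hs
    rcases prefix_snoc_cases ht with rfl | ht'
    · exact hs
    rcases nil_or_snoc r with rfl | ⟨q, a, rfl⟩
    · simp at hes
    rcases prefix_snoc_cases ht' with rfl | ht''
    · simp at hes he; omega
    · refine ih (h.even_closed q a b (by simpa using hs)) ht'' he ?_
      simp at hl; omega

theorem IsStrategy.det' {σ : Set (List N.M)} (h : IsStrategy N.toGame σ) {s r t : List N.M}
    {x y : N.M} (hr : r ∈ σ) (ht : t ∈ σ) (hr' : s ++ [x] <+: r) (ht' : s ++ [y] <+: t)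
    (hs : s.length % 2 = 1) : x = y :=
  h.det s x y (h.prefix_mem _ hr hr' (by simp; omega) le_rfl)
    (h.prefix_mem _ ht ht' (by simp; omega) le_rfl)

/-- A sufficient criterion for being a strategy on a negative game. -/
theorem isStrategy_of {σ : Set (List N.M)} (h0 : [] ∈ σ) (h1 : ∀ s ∈ σ, s ∈ N.plays)
    (h2 : ∀ s ∈ σ, s.length % 2 = 0) (h3 : ∀ s a b, s ++ [a, b] ∈ σ → s ∈ σ)
    (h4 : ∀ s a b, s ++ [a] ∈ σ → s ++ [b] ∈ σ → a = b) : IsStrategy N.toGame σ where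
  subset := h1
  last := fun s a hs => by
    rw [N.lab_eq (h1 _ hs), turn_eq_P]
    have := h2 _ hs
    simp at this; omega
  even_closed := h3
  det := h4
  start_of_empty := fun h => by rw [h] at h0; exact h0.elim
  start_of_nil_mem := fun _ => N.start_eq

/-! Restatements for strategies on `A ⊸ B`, with the type of moves unfolded. -/

theorem lolli_nil {σ : Set (List (B.M ⊕ A.M))} (h : IsStrategy (A.lolli B).toGame σ) :
    ([] : List (B.M ⊕ A.M)) ∈ σ := h.nil_mem

theorem lolli_even {σ : Set (List (B.M ⊕ A.M))} (h : IsStrategy (A.lolli B).toGame σ)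
    {s : List (B.M ⊕ A.M)} (hs : s ∈ σ) : s.length % 2 = 0 := h.even hs

theorem lolli_subset {σ : Set (List (B.M ⊕ A.M))} (h : IsStrategy (A.lolli B).toGame σ)
    {s : List (B.M ⊕ A.M)} (hs : s ∈ σ) : s ∈ (A.lolli B).plays := h.subset hs

theorem lolli_prefix {σ : Set (List (B.M ⊕ A.M))} (h : IsStrategy (A.lolli B).toGame σ)
    {s t : List (B.M ⊕ A.M)} (hs : s ∈ σ) (ht : t <+: s) (he : t.length % 2 = 0) : t ∈ σ :=
  h.prefix_mem _ hs ht he le_rfl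

theorem lolli_det {σ : Set (List (B.M ⊕ A.M))} (h : IsStrategy (A.lolli B).toGame σ)
    {s r t : List (B.M ⊕ A.M)} {x y : B.M ⊕ A.M} (hr : r ∈ σ) (ht : t ∈ σ)
    (hr' : s ++ [x] <+: r) (ht' : s ++ [y] <+: t) (hs : s.length % 2 = 1) : x = y :=
  h.det' hr ht hr' ht' hs

theorem lolli_isStrategy {σ : Set (List (B.M ⊕ A.M))} (h0 : ([] : List (B.M ⊕ A.M)) ∈ σ)
    (h1 : ∀ s : List (B.M ⊕ A.M), s ∈ σ → s ∈ (A.lolli B).plays)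
    (h2 : ∀ s : List (B.M ⊕ A.M), s ∈ σ → s.length % 2 = 0)
    (h3 : ∀ (s : List (B.M ⊕ A.M)) (a b : B.M ⊕ A.M), s ++ [a, b] ∈ σ → s ∈ σ)
    (h4 : ∀ (s : List (B.M ⊕ A.M)) (a b : B.M ⊕ A.M), s ++ [a] ∈ σ → s ++ [b] ∈ σ → a = b) :
    IsStrategy (A.lolli B).toGame σ :=
  isStrategy_of h0 h1 h2 h3 h4

end Plays

/-! ### Composition -/

/-- Restriction of an interaction on `X + Y + Z` to its first two components. As for `A ⊸ B`, the
target is on the left. -/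
def proj12 {X Y Z : Type*} : X ⊕ (Y ⊕ Z) → Option (Y ⊕ X)
  | .inl a => some (.inr a)
  | .inr (.inl b) => some (.inl b)
  | .inr (.inr _) => none

/-- Restriction to the last two components. -/
def proj23 {X Y Z : Type*} : X ⊕ (Y ⊕ Z) → Option (Z ⊕ Y)
  | .inl _ => none
  | .inr (.inl b) => some (.inr b)
  | .inr (.inr c) => some (.inl c)

/-- Restriction to the outer components, hiding the middle one. -/
def proj13 {X Y Z : Type*} : X ⊕ (Y ⊕ Z) → Option (Z ⊕ X)
  | .inl a => some (.inr a)
  | .inr (.inl _) => none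
  | .inr (.inr c) => some (.inl c)

/-- Parallel composition plus hiding: the set of the restrictions to the outer components of the
sequences `s` whose restrictions to the first two and to the last two components are in `σ` and
in `τ`. -/
def compSet {X Y Z : Type u} (σ : Set (List (Y ⊕ X))) (τ : Set (List (Z ⊕ Y))) :
    Set (List (Z ⊕ X)) :=
  {t | ∃ s : List (X ⊕ (Y ⊕ Z)),
    s.filterMap proj12 ∈ σ ∧ s.filterMap proj23 ∈ τ ∧ s.filterMap proj13 = t}

/-- The copycat strategy on `A ⊸ B` along a relabelling of the moves of `B` as moves of `A`: the
plays (in which Player has moved last) such that for every prefix of even length the restriction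
to `A` is the relabelled restriction to `B`. -/
def copycat (A B : NegGame.{u}) (φ : B.M → A.M) : Set (List (B.M ⊕ A.M)) :=
  {s | s ∈ (A.lolli B).plays ∧ s.length % 2 = 0 ∧ ∀ t, t <+: s → t.length % 2 = 0 →
    t.filterMap Sum.getRight? = (t.filterMap Sum.getLeft?).map φ}

section Composition

variable {A B C D : NegGame.{u}}

/-- The three single components of an interaction. -/
def comp1 {X Y Z : Type*} : X ⊕ (Y ⊕ Z) → Option X
  | .inl a => some a
  | .inr _ => none

def comp2 {X Y Z : Type*} : X ⊕ (Y ⊕ Z) → Option Y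
  | .inr (.inl b) => some b
  | _ => none

def comp3 {X Y Z : Type*} : X ⊕ (Y ⊕ Z) → Option Z
  | .inr (.inr c) => some c
  | _ => none

section
variable {X Y Z : Type*} (s : List (X ⊕ (Y ⊕ Z)))

theorem proj12_L : (s.filterMap proj12).filterMap Sum.getLeft? = s.filterMap comp2 :=
  filterMap_comp (by rintro (_ | _ | _) <;> rfl) s
theorem proj12_R : (s.filterMap proj12).filterMap Sum.getRight? = s.filterMap comp1 :=
  filterMap_comp (by rintro (_ | _ | _) <;> rfl) s
theorem proj23_L : (s.filterMap proj23).filterMap Sum.getLeft? = s.filterMap comp3 :=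
  filterMap_comp (by rintro (_ | _ | _) <;> rfl) s
theorem proj23_R : (s.filterMap proj23).filterMap Sum.getRight? = s.filterMap comp2 :=
  filterMap_comp (by rintro (_ | _ | _) <;> rfl) s
theorem proj13_L : (s.filterMap proj13).filterMap Sum.getLeft? = s.filterMap comp3 :=
  filterMap_comp (by rintro (_ | _ | _) <;> rfl) s
theorem proj13_R : (s.filterMap proj13).filterMap Sum.getRight? = s.filterMap comp1 :=
  filterMap_comp (by rintro (_ | _ | _) <;> rfl) s

theorem len12 : (s.filterMap proj12).length =
    (s.filterMap comp2).length + (s.filterMap comp1).length := by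
  rw [length_sum, proj12_L, proj12_R]
theorem len23 : (s.filterMap proj23).length =
    (s.filterMap comp3).length + (s.filterMap comp2).length := by
  rw [length_sum, proj23_L, proj23_R]
theorem len13 : (s.filterMap proj13).length =
    (s.filterMap comp3).length + (s.filterMap comp1).length := by
  rw [length_sum, proj13_L, proj13_R]

/-- The parity invariant of interactions. -/
def Par : Prop :=
  (s.filterMap comp1).length % 2 ≤ (s.filterMap comp2).length % 2 ∧
    (s.filterMap comp2).length % 2 ≤ (s.filterMap comp3).length % 2

variable {s} {x : X ⊕ (Y ⊕ Z)}

theorem step23 (h : Par s) (h' : Par (s ++ [x]))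
    (e : (s.filterMap comp2).length % 2 ≠ (s.filterMap comp3).length % 2) :
    ∃ m, proj23 x = some m := by
  unfold Par at h h'
  rcases x with a | b | c
  · simp only [fm_snoc, comp1, comp2, comp3, Option.toList, List.append_nil, List.length_append,
      List.length_singleton] at h'
    omega
  · exact ⟨_, rfl⟩
  · exact ⟨_, rfl⟩

theorem step12 (h : Par s) (h' : Par (s ++ [x]))
    (e : (s.filterMap comp1).length % 2 ≠ (s.filterMap comp2).length % 2) :
    ∃ m, proj12 x = some m := by
  unfold Par at h h'
  rcases x with a | b | c
  · exact ⟨_, rfl⟩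
  · exact ⟨_, rfl⟩
  · simp only [fm_snoc, comp1, comp2, comp3, Option.toList, List.append_nil, List.length_append,
      List.length_singleton] at h'
    omega

theorem step13 (h' : Par (s ++ [x]))
    (e : (s.filterMap comp1).length % 2 = (s.filterMap comp2).length % 2)
    (e' : (s.filterMap comp2).length % 2 = (s.filterMap comp3).length % 2) :
    ∃ m, proj13 x = some m := by
  unfold Par at h'
  rcases x with a | b | c
  · exact ⟨_, rfl⟩
  · simp only [fm_snoc, comp1, comp2, comp3, Option.toList, List.append_nil, List.length_append,
      List.length_singleton] at h'
    omega
  · exact ⟨_, rfl⟩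

end

theorem inter_par {s : List (A.M ⊕ (B.M ⊕ C.M))} (h12 : s.filterMap proj12 ∈ (A.lolli B).plays)
    (h23 : s.filterMap proj23 ∈ (B.lolli C).plays) (t) (ht : t <+: s) : Par t := by
  have h1 := (mem_lolli.1 h12).2.2 _ (ht.filterMap _)
  have h2 := (mem_lolli.1 h23).2.2 _ (ht.filterMap _)
  rw [proj12_L, proj12_R] at h1
  rw [proj23_L, proj23_R] at h2
  exact ⟨h1, h2⟩

theorem comp_plays {s : List (A.M ⊕ (B.M ⊕ C.M))} (h12 : s.filterMap proj12 ∈ (A.lolli B).plays)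
    (h23 : s.filterMap proj23 ∈ (B.lolli C).plays) : s.filterMap proj13 ∈ (A.lolli C).plays := by
  rw [mem_lolli, proj13_L, proj13_R]
  refine ⟨?_, ?_, ?_⟩
  · rw [← proj23_L]; exact (mem_lolli.1 h23).1
  · rw [← proj12_R]; exact (mem_lolli.1 h12).2.1
  · intro t ht
    obtain ⟨t', ht', rfl⟩ := prefix_lift ht
    have := inter_par h12 h23 t' ht'
    rw [proj13_L, proj13_R]
    exact this.1.trans this.2

theorem diverge {X : Type*} (s t : List X) : s <+: t ∨ t <+: s ∨
    ∃ w x y, x ≠ y ∧ w ++ [x] <+: s ∧ w ++ [y] <+: t := by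
  induction s generalizing t with
  | nil => exact Or.inl List.nil_prefix
  | cons a s ih =>
    rcases t with _ | ⟨b, t⟩
    · exact Or.inr (Or.inl List.nil_prefix)
    by_cases hab : a = b
    · subst hab
      rcases ih t with h | h | ⟨w, x, y, h, h1, h2⟩
      · exact Or.inl (List.cons_prefix_cons.2 ⟨rfl, h⟩)
      · exact Or.inr (Or.inl (List.cons_prefix_cons.2 ⟨rfl, h⟩))
      · exact Or.inr (Or.inr ⟨a :: w, x, y, h, List.cons_prefix_cons.2 ⟨rfl, h1⟩,
          List.cons_prefix_cons.2 ⟨rfl, h2⟩⟩)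
    · exact Or.inr (Or.inr ⟨[], a, b, hab, ⟨s, rfl⟩, ⟨t, rfl⟩⟩)

theorem snoc_prefix {X Y : Type*} {f : X → Option Y} {w s : List X} {x : X} {m : Y}
    (h : w ++ [x] <+: s) (hm : f x = some m) : w.filterMap f ++ [m] <+: s.filterMap f := by
  have := h.filterMap f
  rwa [fm_snoc, hm] at this

theorem snoc_inj {X : Type*} {u : List X} {w : List X} {a b x y : X}
    (h : w ++ [x] <+: u ++ [a]) (h' : w ++ [y] <+: u ++ [b]) (hl : w.length < u.length) :
    x = y := by
  have h1 : w ++ [x] <+: u := by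
    rcases prefix_snoc_cases h with h | h
    · have := congrArg List.length h; simp at this; omega
    · exact h
  have h2 : w ++ [y] <+: u := by
    rcases prefix_snoc_cases h' with h | h
    · have := congrArg List.length h; simp at this; omega
    · exact h
  have := List.prefix_of_prefix_length_le h1 h2 (by simp)
  have h3 := this.eq_of_length (by simp)
  simpa using h3

theorem proj12_inj {X Y Z : Type*} {x y : X ⊕ (Y ⊕ Z)} {m : Y ⊕ X} (h : proj12 x = some m)
    (h' : proj12 y = some m) : x = y := by
  rcases x with _ | _ | _ <;> rcases y with _ | _ | _ <;> cases h <;> cases h' <;> rfl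

theorem proj23_inj {X Y Z : Type*} {x y : X ⊕ (Y ⊕ Z)} {m : Z ⊕ Y} (h : proj23 x = some m)
    (h' : proj23 y = some m) : x = y := by
  rcases x with _ | _ | _ <;> rcases y with _ | _ | _ <;> cases h <;> cases h' <;> rfl

theorem proj13_inj {X Y Z : Type*} {x y : X ⊕ (Y ⊕ Z)} {m : Z ⊕ X} (h : proj13 x = some m)
    (h' : proj13 y = some m) : x = y := by
  rcases x with _ | _ | _ <;> rcases y with _ | _ | _ <;> cases h <;> cases h' <;> rfl

theorem comp_isStrategy {σ : Set (List (B.M ⊕ A.M))} {τ : Set (List (C.M ⊕ B.M))}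
    (hσ : IsStrategy (A.lolli B).toGame σ) (hτ : IsStrategy (B.lolli C).toGame τ) :
    IsStrategy (A.lolli C).toGame (compSet (X := A.M) (Y := B.M) (Z := C.M) σ τ) := by
  have heven : ∀ s : List (A.M ⊕ (B.M ⊕ C.M)), s.filterMap proj12 ∈ σ → s.filterMap proj23 ∈ τ →
      (s.filterMap proj13).length % 2 = 0 := by
    intro s h1 h2
    have e1 := lolli_even hσ h1
    have e2 := lolli_even hτ h2
    rw [len12] at e1
    rw [len23] at e2
    rw [len13]
    omega
  refine lolli_isStrategy ⟨[], lolli_nil hσ, lolli_nil hτ, rfl⟩ ?_ ?_ ?_ ?_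
  · rintro _ ⟨s, h1, h2, rfl⟩
    exact comp_plays (lolli_subset hσ h1) (lolli_subset hτ h2)
  · rintro _ ⟨s, h1, h2, rfl⟩
    exact heven s h1 h2
  · rintro u a b ⟨s, h1, h2, h3⟩
    obtain ⟨s', hs', e⟩ := prefix_lift (f := proj13) (s := s) (t := u) (by rw [h3]; exact ⟨_, rfl⟩)
    have hp := inter_par (lolli_subset hσ h1) (lolli_subset hτ h2) s' hs'
    have hl := heven s h1 h2
    rw [h3] at hl
    have hl' := len13 s'
    rw [e] at hl'
    have hu : u.length % 2 = 0 := by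
      simp at hl; omega
    unfold Par at hp
    refine ⟨s', lolli_prefix hσ h1 (hs'.filterMap _) ?_,
      lolli_prefix hτ h2 (hs'.filterMap _) ?_, e⟩
    · rw [len12]; omega
    · rw [len23]; omega
  · rintro u a b ⟨s, h1, h2, h3⟩ ⟨r, k1, k2, k3⟩
    rcases diverge s r with h | h | ⟨w, x, y, hxy, hx, hy⟩
    · have := h.filterMap proj13
      rw [h3, k3] at this
      simpa using this.eq_of_length (by simp)
    · have := h.filterMap proj13
      rw [h3, k3] at this
      simpa using (this.eq_of_length (by simp)).symm
    · exfalso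
      apply hxy
      have hw : w <+: s := (List.prefix_append _ _).trans hx
      have p0 := inter_par (lolli_subset hσ h1) (lolli_subset hτ h2) w hw
      have p1 := inter_par (lolli_subset hσ h1) (lolli_subset hτ h2) _ hx
      have p2 := inter_par (lolli_subset hσ k1) (lolli_subset hτ k2) _ hy
      by_cases e23 : (w.filterMap comp2).length % 2 = (w.filterMap comp3).length % 2
      · by_cases e12 : (w.filterMap comp1).length % 2 = (w.filterMap comp2).length % 2
        · obtain ⟨m, hm⟩ := step13 p1 e12 e23
          obtain ⟨m', hm'⟩ := step13 p2 e12 e23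
          have q1 := snoc_prefix hx hm
          have q2 := snoc_prefix hy hm'
          have hl := heven s h1 h2
          have hq := q1.length_le
          rw [h3] at q1 hl hq
          rw [k3] at q2
          have hl' := len13 w
          have : m = m' := snoc_inj q1 q2 (by
            simp only [List.length_append, List.length_singleton] at hl hq
            omega)
          subst this
          exact proj13_inj hm hm'
        · obtain ⟨m, hm⟩ := step12 p0 p1 e12
          obtain ⟨m', hm'⟩ := step12 p0 p2 e12
          have hl' := len12 w
          have : m = m' := lolli_det hσ h1 k1 (snoc_prefix hx hm) (snoc_prefix hy hm') (by
            rw [hl']; omega)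
          subst this
          exact proj12_inj hm hm'
      · obtain ⟨m, hm⟩ := step23 p0 p1 e23
        obtain ⟨m', hm'⟩ := step23 p0 p2 e23
        have hl' := len23 w
        have : m = m' := lolli_det hτ h2 k2 (snoc_prefix hx hm) (snoc_prefix hy hm') (by
          rw [hl']; omega)
        subst this
        exact proj23_inj hm hm'

theorem compSet_assoc {X Y Z W : Type u} (σ : Set (List (Y ⊕ X))) (τ : Set (List (Z ⊕ Y)))
    (υ : Set (List (W ⊕ Z))) :
    compSet (compSet σ τ) υ = compSet σ (compSet τ υ) := by
  ext t
  constructor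
  · rintro ⟨s, ⟨r, h1, h2, h3⟩, h4, rfl⟩
    obtain ⟨w, rfl, rfl⟩ := amalgam
      (X := X ⊕ (Y ⊕ (Z ⊕ W)))
      (fun x => match x with
        | .inl a => some (.inl a)
        | .inr (.inl _) => none
        | .inr (.inr (.inl c)) => some (.inr (.inl c))
        | .inr (.inr (.inr d)) => some (.inr (.inr d)))
      (fun x => match x with
        | .inl a => some (.inl a)
        | .inr (.inl b) => some (.inr (.inl b))
        | .inr (.inr (.inl c)) => some (.inr (.inr c))
        | .inr (.inr (.inr _)) => none)
      proj12 proj13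
      (by
        rintro (a | c | d) h
        · simp [proj12] at h
        · simp [proj12] at h
        · exact ⟨.inr (.inr (.inr d)), rfl, rfl⟩)
      (by
        rintro (a | b | c) h
        · simp [proj13] at h
        · exact ⟨.inr (.inl b), rfl, rfl⟩
        · simp [proj13] at h)
      (by
        rintro (a | c | d) (a' | b' | c') v h h' <;> cases h <;> cases h'
        · exact ⟨.inl a, rfl, rfl⟩
        · exact ⟨.inr (.inr (.inl c)), rfl, rfl⟩)
      s r h3.symm
    refine ⟨w.filterMap (fun x => match x with
        | .inl a => some (.inl a)
        | .inr (.inl b) => some (.inr (.inl b))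
        | .inr (.inr (.inl _)) => none
        | .inr (.inr (.inr d)) => some (.inr (.inr d))), ?_, ⟨w.filterMap (fun x => match x with
        | .inl _ => none
        | .inr (.inl b) => some (.inl b)
        | .inr (.inr (.inl c)) => some (.inr (.inl c))
        | .inr (.inr (.inr d)) => some (.inr (.inr d))), ?_, ?_, ?_⟩, ?_⟩
    · convert h1 using 1
      simp only [List.filterMap_filterMap]
      congr 1; funext x; rcases x with _ | _ | _ | _ <;> rfl
    · convert h2 using 1
      simp only [List.filterMap_filterMap]
      congr 1; funext x; rcases x with _ | _ | _ | _ <;> rfl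
    · convert h4 using 1
      simp only [List.filterMap_filterMap]
      congr 1; funext x; rcases x with _ | _ | _ | _ <;> rfl
    · simp only [List.filterMap_filterMap]
      congr 1; funext x; rcases x with _ | _ | _ | _ <;> rfl
    · simp only [List.filterMap_filterMap]
      congr 1; funext x; rcases x with _ | _ | _ | _ <;> rfl
  · rintro ⟨s, h4, ⟨r, h1, h2, h3⟩, rfl⟩
    obtain ⟨w, rfl, rfl⟩ := amalgam
      (X := X ⊕ (Y ⊕ (Z ⊕ W)))
      (fun x => match x with
        | .inl a => some (.inl a)
        | .inr (.inl b) => some (.inr (.inl b))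
        | .inr (.inr (.inl _)) => none
        | .inr (.inr (.inr d)) => some (.inr (.inr d)))
      (fun x => match x with
        | .inl _ => none
        | .inr (.inl b) => some (.inl b)
        | .inr (.inr (.inl c)) => some (.inr (.inl c))
        | .inr (.inr (.inr d)) => some (.inr (.inr d)))
      proj23 proj13
      (by
        rintro (a | b | d) h
        · exact ⟨.inl a, rfl, rfl⟩
        · simp [proj23] at h
        · simp [proj23] at h)
      (by
        rintro (b | c | d) h
        · simp [proj13] at h
        · exact ⟨.inr (.inr (.inl c)), rfl, rfl⟩
        · simp [proj13] at h)
      (by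
        rintro (a | b | d) (b' | c' | d') v h h' <;> cases h <;> cases h'
        · exact ⟨.inr (.inl b), rfl, rfl⟩
        · exact ⟨.inr (.inr (.inr d)), rfl, rfl⟩)
      s r h3.symm
    refine ⟨w.filterMap (fun x => match x with
        | .inl a => some (.inl a)
        | .inr (.inl _) => none
        | .inr (.inr (.inl c)) => some (.inr (.inl c))
        | .inr (.inr (.inr d)) => some (.inr (.inr d))), ⟨w.filterMap (fun x => match x with
        | .inl a => some (.inl a)
        | .inr (.inl b) => some (.inr (.inl b))
        | .inr (.inr (.inl c)) => some (.inr (.inr c))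
        | .inr (.inr (.inr _)) => none), ?_, ?_, ?_⟩, ?_, ?_⟩
    · convert h4 using 1
      simp only [List.filterMap_filterMap]
      congr 1; funext x; rcases x with _ | _ | _ | _ <;> rfl
    · convert h1 using 1
      simp only [List.filterMap_filterMap]
      congr 1; funext x; rcases x with _ | _ | _ | _ <;> rfl
    · simp only [List.filterMap_filterMap]
      congr 1; funext x; rcases x with _ | _ | _ | _ <;> rfl
    · convert h2 using 1
      simp only [List.filterMap_filterMap]
      congr 1; funext x; rcases x with _ | _ | _ | _ <;> rfl
    · simp only [List.filterMap_filterMap]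
      congr 1; funext x; rcases x with _ | _ | _ | _ <;> rfl

end Composition

/-! ### Copycat strategies and identities -/

section Copycat

variable {A B N M : NegGame.{u}}

theorem even_cases {X : Type*} {s : List X} (h : s.length % 2 = 0) :
    s = [] ∨ ∃ r x y, s = r ++ [x, y] ∧ r.length % 2 = 0 := by
  rcases nil_or_snoc s with rfl | ⟨q, y, rfl⟩
  · exact Or.inl rfl
  rcases nil_or_snoc q with rfl | ⟨r, x, rfl⟩
  · simp at h
  · refine Or.inr ⟨r, x, y, by simp, ?_⟩
    simp at h; omega

theorem pair_cases {X Y : Type*} {φ : Y → X} {r : List (Y ⊕ X)} {x y : Y ⊕ X}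
    (h : r.filterMap Sum.getRight? = (r.filterMap Sum.getLeft?).map φ)
    (h' : (r ++ [x, y]).filterMap Sum.getRight? =
      ((r ++ [x, y]).filterMap Sum.getLeft?).map φ) :
    ∃ m, (x = .inl m ∧ y = .inr (φ m)) ∨ (x = .inr (φ m) ∧ y = .inl m) := by
  rcases x with x | x <;> rcases y with y | y <;>
    simp [List.filterMap_append, List.filterMap_cons, h] at h'
  · exact ⟨x, Or.inl ⟨rfl, by rw [h']⟩⟩
  · exact ⟨y, Or.inr ⟨by rw [h'], rfl⟩⟩

theorem copycat_isStrategy {φ : B.M → A.M} (hφ : Function.Injective φ) :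
    IsStrategy (A.lolli B).toGame (copycat A B φ) := by
  refine lolli_isStrategy ⟨(A.lolli B).nil_mem, rfl, ?_⟩ (fun s h => h.1) (fun s h => h.2.1) ?_ ?_
  · intro t ht _
    rw [List.prefix_nil.1 ht]; rfl
  · rintro s a b ⟨h1, h2, h3⟩
    refine ⟨(A.lolli B).prefix_closed _ h1 _ ⟨[a, b], rfl⟩, ?_,
      fun t ht => h3 t (ht.trans ⟨[a, b], rfl⟩)⟩
    simp at h2; omega
  · rintro s a b ⟨h1, h2, h3⟩ ⟨k1, k2, k3⟩
    rcases nil_or_snoc s with rfl | ⟨r, x, rfl⟩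
    · simp at h2
    rw [List.append_assoc] at h2 h3 k3 k2
    have e0 := h3 r ⟨_, rfl⟩ (by simp at h2; omega)
    obtain ⟨m, h | h⟩ := pair_cases e0 (h3 _ List.prefix_rfl h2) <;>
      obtain ⟨m', h' | h'⟩ := pair_cases e0 (k3 _ List.prefix_rfl k2)
    · obtain ⟨rfl, rfl⟩ := h
      obtain ⟨h, rfl⟩ := h'
      cases h; rfl
    · obtain ⟨rfl, rfl⟩ := h
      cases h'.1
    · obtain ⟨rfl, rfl⟩ := h
      cases h'.1
    · obtain ⟨rfl, rfl⟩ := h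
      obtain ⟨h, rfl⟩ := h'
      rw [hφ (Sum.inr.inj h)]

/-- The copycat play on `A ⊸ A` that copies the play `t` of `A`. -/
def cc1 (l : A.M → Player) (a : A.M) : List (A.M ⊕ A.M) :=
  match l a with
  | .O => [.inl a, .inr a]
  | .P => [.inr a, .inl a]

def cc (A : NegGame.{u}) (t : List A.M) : List (A.M ⊕ A.M) := t.flatMap (cc1 A.lab)

theorem cc_L (t : List A.M) : (cc A t).filterMap Sum.getLeft? = t := by
  induction t with
  | nil => rfl
  | cons a t ih =>
    unfold cc at ih ⊢
    rw [List.flatMap_cons, List.filterMap_append, ih]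
    unfold cc1
    cases A.lab a <;> rfl

theorem cc_R (t : List A.M) : (cc A t).filterMap Sum.getRight? = t := by
  induction t with
  | nil => rfl
  | cons a t ih =>
    unfold cc at ih ⊢
    rw [List.flatMap_cons, List.filterMap_append, ih]
    unfold cc1
    cases A.lab a <;> rfl

theorem cc_prefix (t : List A.M) (ht : t ∈ A.plays) : ∀ r, r <+: cc A t →
    (r.filterMap Sum.getRight?).length % 2 ≤ (r.filterMap Sum.getLeft?).length % 2 ∧
    (r.length % 2 = 0 → r.filterMap Sum.getRight? = r.filterMap Sum.getLeft?) := by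
  induction t using List.reverseRecOn with
  | nil =>
    intro r hr
    rw [List.prefix_nil.1 hr]
    exact ⟨le_rfl, fun _ => rfl⟩
  | append_singleton t a ih =>
    have hlab := A.lab_eq ht
    replace ih := ih (A.prefix_closed _ ht _ ⟨_, rfl⟩)
    intro r hr
    have hL := cc_L (t ++ [a])
    have hR := cc_R (t ++ [a])
    have hlen := length_sum (cc A t)
    rw [cc_L, cc_R] at hlen
    have he : cc A (t ++ [a]) = cc A t ++ cc1 A.lab a := by
      unfold cc; rw [List.flatMap_append]; simp
    rw [he] at hr hL hR
    unfold cc1 at hr hL hR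
    rcases hl : A.lab a with _ | _ <;> rw [hl] at hr hL hR hlab
    · have hpar := turn_eq_O.1 hlab.symm
      simp only at hr hL hR
      rw [show [Sum.inl a, Sum.inr a] = [Sum.inl a] ++ [Sum.inr a] from rfl,
        ← List.append_assoc] at hr hL hR
      rcases prefix_snoc_cases hr with rfl | hr
      · rw [hL, hR]; exact ⟨le_rfl, fun _ => rfl⟩
      rcases prefix_snoc_cases hr with rfl | hr
      · rw [fm_snoc, fm_snoc, cc_L, cc_R]
        simp
        omega
      · exact ih r hr
    · have hpar := turn_eq_P.1 hlab.symm
      simp only at hr hL hR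
      rw [show [Sum.inr a, Sum.inl a] = [Sum.inr a] ++ [Sum.inl a] from rfl,
        ← List.append_assoc] at hr hL hR
      rcases prefix_snoc_cases hr with rfl | hr
      · rw [hL, hR]; exact ⟨le_rfl, fun _ => rfl⟩
      rcases prefix_snoc_cases hr with rfl | hr
      · rw [fm_snoc, fm_snoc, cc_L, cc_R]
        simp
        omega
      · exact ih r hr

theorem cc_mem {t : List A.M} (ht : t ∈ A.plays) : cc A t ∈ copycat A A id := by
  refine ⟨mem_lolli.2 ⟨by rwa [cc_L], by rwa [cc_R], fun r hr => (cc_prefix t ht r hr).1⟩, ?_, ?_⟩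
  · rw [length_sum, cc_L, cc_R]; omega
  · intro r hr he
    rw [List.map_id]
    exact (cc_prefix t ht r hr).2 he

theorem eq_cc : ∀ (n : ℕ) {s : List (A.M ⊕ A.M)}, s.length ≤ n → s ∈ copycat A A id →
    s = cc A (s.filterMap Sum.getLeft?) := by
  intro n
  induction n with
  | zero =>
    intro s hn _
    rw [List.length_eq_zero_iff.1 (Nat.le_zero.1 hn)]; rfl
  | succ n ih =>
    intro s hn hs
    rcases even_cases hs.2.1 with rfl | ⟨r, x, y, rfl, hr⟩
    · rfl
    have hr' : r ∈ copycat A A id := lolli_prefix (copycat_isStrategy Function.injective_id) hs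
      ⟨_, rfl⟩ hr
    have e := ih (by simp at hn; omega) hr'
    have hlr := hr'.2.2 r List.prefix_rfl hr
    rw [List.map_id] at hlr
    have hpre := mem_lolli.1 hs.1
    have hx := hpre.2.2 (r ++ [x]) ⟨[y], by simp⟩
    have hr2 := hpre.2.2 r ⟨[x, y], by simp⟩
    have hsl := hpre.1
    have hcc : ∀ m, cc A (r.filterMap Sum.getLeft? ++ [m]) = r ++ cc1 A.lab m := by
      intro m
      unfold cc at e ⊢
      rw [List.flatMap_append, ← e]; simp
    obtain ⟨m, ⟨rfl, rfl⟩ | ⟨rfl, rfl⟩⟩ :=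
      pair_cases (hr'.2.2 r List.prefix_rfl hr) (hs.2.2 _ List.prefix_rfl hs.2.1)
    · have e2 : (r ++ [Sum.inl m, Sum.inr m]).filterMap Sum.getLeft? =
          r.filterMap Sum.getLeft? ++ [m] := by simp [List.filterMap_cons]
      simp only [id] at hsl ⊢
      rw [e2] at hsl ⊢
      have hm := A.lab_eq hsl
      rw [hcc]
      rw [fm_snoc, fm_snoc, hlr] at hx
      simp at hx
      rw [turn_eq_O.2 (by omega)] at hm
      unfold cc1; rw [hm]
    · have e2 : (r ++ [Sum.inr m, Sum.inl m]).filterMap Sum.getLeft? =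
          r.filterMap Sum.getLeft? ++ [m] := by simp [List.filterMap_cons]
      simp only [id] at hsl ⊢
      rw [e2] at hsl ⊢
      have hm := A.lab_eq hsl
      rw [hcc]
      rw [fm_snoc, fm_snoc, hlr] at hx
      simp at hx
      rw [turn_eq_P.2 (by omega)] at hm
      unfold cc1; rw [hm]

/-- Insertion of the copied moves on the left. -/
def dblL1 (A B : NegGame.{u}) : B.M ⊕ A.M → List (A.M ⊕ (A.M ⊕ B.M))
  | .inl b => [.inr (.inr b)]
  | .inr a => match A.lab a with
    | .O => [.inr (.inl a), .inl a]
    | .P => [.inl a, .inr (.inl a)]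

/-- Insertion of the copied moves on the right. -/
def dblR1 (A B : NegGame.{u}) : B.M ⊕ A.M → List (A.M ⊕ (B.M ⊕ B.M))
  | .inr a => [.inl a]
  | .inl b => match B.lab b with
    | .O => [.inr (.inr b), .inr (.inl b)]
    | .P => [.inr (.inl b), .inr (.inr b)]

theorem fm_flatMap {X Y Z : Type*} (f : X → List Y) (g : Y → Option Z) (h : X → List Z)
    (H : ∀ x, (f x).filterMap g = h x) (t : List X) :
    (t.flatMap f).filterMap g = t.flatMap h := by
  induction t with
  | nil => rfl
  | cons x t ih => rw [List.flatMap_cons, List.filterMap_append, ih, H, List.flatMap_cons]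

theorem fm_eq_flatMap {X Z : Type*} (f : X → Option Z) (t : List X) :
    t.filterMap f = t.flatMap (fun x => (f x).toList) := by
  induction t with
  | nil => rfl
  | cons x t ih => rw [List.flatMap_cons, ← ih]; cases h : f x <;> simp [h]

theorem flatMap_single {X : Type*} (t : List X) : t.flatMap (fun x => [x]) = t := by
  induction t with
  | nil => rfl
  | cons x t ih => rw [List.flatMap_cons, ih]; rfl

theorem id_interL : ∀ (n : ℕ) (s : List (A.M ⊕ (A.M ⊕ B.M))), s.length ≤ n →
    (∀ t, t <+: s → Par t) →
    (∀ t, t <+: s → (t.filterMap proj12).length % 2 = 0 →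
      t.filterMap comp1 = t.filterMap comp2) →
    (s.filterMap proj12).length % 2 = 0 → s.filterMap proj13 = s.filterMap proj23 := by
  intro n
  induction n with
  | zero =>
    intro s hn _ _ _
    rw [List.length_eq_zero_iff.1 (Nat.le_zero.1 hn)]; rfl
  | succ n ih =>
    intro s hn hp hc he
    have ih' : ∀ t, t <+: s → t.length < s.length → (t.filterMap proj12).length % 2 = 0 →
        t.filterMap proj13 = t.filterMap proj23 := fun t ht hl he' =>
      ih t (by omega) (fun r hr => hp r (hr.trans ht)) (fun r hr => hc r (hr.trans ht)) he'
    rcases nil_or_snoc s with rfl | ⟨r, x, rfl⟩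
    · rfl
    have pr := hp r ⟨_, rfl⟩
    have lr := len12 r
    rcases hx : proj12 x with _ | m
    · have e := ih' r ⟨_, rfl⟩ (by simp) (by rw [fm_snoc, hx] at he; simpa using he)
      rcases x with a | a | b
      · cases hx
      · cases hx
      · rw [fm_snoc, fm_snoc, e]; rfl
    · have hro : (r.filterMap proj12).length % 2 = 1 := by
        rw [fm_snoc, hx] at he; simp at he; omega
      rcases nil_or_snoc r with rfl | ⟨q, y, rfl⟩
      · simp at hro
      have pq := hp q ⟨[y, x], by simp⟩
      have lq := len12 q
      have hqe : ∀ m, proj12 y = some m → (q.filterMap proj12).length % 2 = 0 := by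
        intro m hm
        rw [fm_snoc, hm] at hro; simp at hro; omega
      have hpre : q <+: q ++ [y] ++ [x] := ⟨[y, x], by simp⟩
      unfold Par at pr pq
      have hs := hc _ List.prefix_rfl he
      rcases y with a | a | b
      · have e := ih' q hpre (by simp) (hqe _ rfl)
        have c := hc q hpre (hqe _ rfl)
        rcases x with a' | a' | b'
        · replace hs := congrArg List.length hs
          simp only [fm_snoc, comp1, comp2, Option.toList, c, List.append_nil, List.length_append,
            List.length_singleton] at hs
          omega
        · simp only [fm_snoc, comp1, comp2, Option.toList, c, List.append_nil,
            List.append_cancel_left_eq, List.cons.injEq, and_true] at hs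
          simp only [fm_snoc, e, hs, proj13, proj23, Option.toList, List.append_nil]
        · cases hx
      · have e := ih' q hpre (by simp) (hqe _ rfl)
        have c := hc q hpre (hqe _ rfl)
        rcases x with a' | a' | b'
        · simp only [fm_snoc, comp1, comp2, Option.toList, c, List.append_nil,
            List.append_cancel_left_eq, List.cons.injEq, and_true] at hs
          simp only [fm_snoc, e, hs, proj13, proj23, Option.toList, List.append_nil]
        · replace hs := congrArg List.length hs
          simp only [fm_snoc, comp1, comp2, Option.toList, c, List.append_nil, List.length_append,
            List.length_singleton] at hs
          omega
        · cases hx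
      · exfalso
        simp only [fm_snoc, comp1, comp2, comp3, proj12, Option.toList, List.append_nil,
          List.length_append, List.length_singleton] at pr hro
        omega

theorem id_interR : ∀ (n : ℕ) (s : List (A.M ⊕ (B.M ⊕ B.M))), s.length ≤ n →
    (∀ t, t <+: s → Par t) →
    (∀ t, t <+: s → (t.filterMap proj23).length % 2 = 0 →
      t.filterMap comp2 = t.filterMap comp3) →
    (s.filterMap proj23).length % 2 = 0 → s.filterMap proj13 = s.filterMap proj12 := by
  intro n
  induction n with
  | zero =>
    intro s hn _ _ _
    rw [List.length_eq_zero_iff.1 (Nat.le_zero.1 hn)]; rfl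
  | succ n ih =>
    intro s hn hp hc he
    have ih' : ∀ t, t <+: s → t.length < s.length → (t.filterMap proj23).length % 2 = 0 →
        t.filterMap proj13 = t.filterMap proj12 := fun t ht hl he' =>
      ih t (by omega) (fun r hr => hp r (hr.trans ht)) (fun r hr => hc r (hr.trans ht)) he'
    rcases nil_or_snoc s with rfl | ⟨r, x, rfl⟩
    · rfl
    have pr := hp r ⟨_, rfl⟩
    have lr := len23 r
    rcases hx : proj23 x with _ | m
    · have e := ih' r ⟨_, rfl⟩ (by simp) (by rw [fm_snoc, hx] at he; simpa using he)
      rcases x with a | b | b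
      · rw [fm_snoc, fm_snoc, e]; rfl
      · cases hx
      · cases hx
    · have hro : (r.filterMap proj23).length % 2 = 1 := by
        rw [fm_snoc, hx] at he; simp at he; omega
      rcases nil_or_snoc r with rfl | ⟨q, y, rfl⟩
      · simp at hro
      have pq := hp q ⟨[y, x], by simp⟩
      have lq := len23 q
      have hqe : ∀ m, proj23 y = some m → (q.filterMap proj23).length % 2 = 0 := by
        intro m hm
        rw [fm_snoc, hm] at hro; simp at hro; omega
      have hpre : q <+: q ++ [y] ++ [x] := ⟨[y, x], by simp⟩
      unfold Par at pr pq
      have hs := hc _ List.prefix_rfl he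
      rcases y with a | b | b
      · exfalso
        simp only [fm_snoc, comp1, comp2, comp3, proj23, Option.toList, List.append_nil,
          List.length_append, List.length_singleton] at pr hro
        omega
      · have e := ih' q hpre (by simp) (hqe _ rfl)
        have c := hc q hpre (hqe _ rfl)
        rcases x with a' | a' | b'
        · cases hx
        · replace hs := congrArg List.length hs
          simp only [fm_snoc, comp2, comp3, Option.toList, c, List.append_nil, List.length_append,
            List.length_singleton] at hs
          omega
        · simp only [fm_snoc, comp2, comp3, Option.toList, c, List.append_nil,
            List.append_cancel_left_eq, List.cons.injEq, and_true] at hs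
          simp only [fm_snoc, e, hs, proj12, proj13, Option.toList, List.append_nil]
      · have e := ih' q hpre (by simp) (hqe _ rfl)
        have c := hc q hpre (hqe _ rfl)
        rcases x with a' | a' | b'
        · cases hx
        · simp only [fm_snoc, comp2, comp3, Option.toList, c, List.append_nil,
            List.append_cancel_left_eq, List.cons.injEq, and_true] at hs
          simp only [fm_snoc, e, hs, proj12, proj13, Option.toList, List.append_nil]
        · replace hs := congrArg List.length hs
          simp only [fm_snoc, comp2, comp3, Option.toList, c, List.append_nil, List.length_append,
            List.length_singleton] at hs
          omega

theorem id_compSet {σ : Set (List (B.M ⊕ A.M))} (hσ : IsStrategy (A.lolli B).toGame σ) :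
    compSet (X := A.M) (Y := A.M) (Z := B.M) (copycat A A id) σ = σ := by
  ext t
  constructor
  · rintro ⟨s, h1, h2, rfl⟩
    have hp := inter_par h1.1 (lolli_subset hσ h2)
    rw [id_interL _ s le_rfl hp ?_ h1.2.1]
    · exact h2
    · intro t ht he
      have := h1.2.2 _ (ht.filterMap _) he
      rwa [proj12_L, proj12_R, List.map_id] at this
  · intro ht
    have hpl := mem_lolli.1 (lolli_subset hσ ht)
    refine ⟨t.flatMap (dblL1 A B), ?_, ?_, ?_⟩
    · convert cc_mem hpl.2.1 using 1
      rw [fm_eq_flatMap Sum.getRight?]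
      unfold cc
      rw [List.flatMap_assoc]
      apply fm_flatMap
      rintro (b | a)
      · rfl
      · simp only [dblL1, Sum.getRight?_inr, Option.toList, List.flatMap_singleton, cc1]
        cases A.lab a <;> rfl
    · convert ht using 1
      conv_rhs => rw [← flatMap_single t]
      apply fm_flatMap
      rintro (b | a)
      · rfl
      · simp only [dblL1]
        cases A.lab a <;> rfl
    · conv_rhs => rw [← flatMap_single t]
      apply fm_flatMap
      rintro (b | a)
      · rfl
      · simp only [dblL1]
        cases A.lab a <;> rfl

theorem compSet_id {σ : Set (List (B.M ⊕ A.M))} (hσ : IsStrategy (A.lolli B).toGame σ) :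
    compSet (X := A.M) (Y := B.M) (Z := B.M) σ (copycat B B id) = σ := by
  ext t
  constructor
  · rintro ⟨s, h1, h2, rfl⟩
    have hp := inter_par (lolli_subset hσ h1) h2.1
    rw [id_interR _ s le_rfl hp ?_ h2.2.1]
    · exact h1
    · intro t ht he
      have := h2.2.2 _ (ht.filterMap _) he
      rwa [proj23_L, proj23_R, List.map_id] at this
  · intro ht
    have hpl := mem_lolli.1 (lolli_subset hσ ht)
    refine ⟨t.flatMap (dblR1 A B), ?_, ?_, ?_⟩
    · convert ht using 1
      conv_rhs => rw [← flatMap_single t]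
      apply fm_flatMap
      rintro (b | a)
      · simp only [dblR1]
        cases B.lab b <;> rfl
      · rfl
    · convert cc_mem hpl.1 using 1
      rw [fm_eq_flatMap Sum.getLeft?]
      unfold cc
      rw [List.flatMap_assoc]
      apply fm_flatMap
      rintro (b | a)
      · simp only [dblR1, Sum.getLeft?_inl, Option.toList, List.flatMap_singleton, cc1]
        cases B.lab b <;> rfl
      · rfl
    · conv_rhs => rw [← flatMap_single t]
      apply fm_flatMap
      rintro (b | a)
      · simp only [dblR1]
        cases B.lab b <;> rfl
      · rfl

end Copycat

/-! ### The action of the sequoid on strategies -/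

/-- Restriction of a play on `(A ⊘ C) ⊸ (B ⊘ D)` to `A` and `B`. -/
def fstPart {X Y Z W : Type*} : (Y ⊕ W) ⊕ (X ⊕ Z) → Option (Y ⊕ X)
  | .inl (.inl b) => some (.inl b)
  | .inr (.inl a) => some (.inr a)
  | _ => none

/-- Restriction of a play on `(A ⊘ C) ⊸ (B ⊘ D)` to `C` and `D`. -/
def sndPart {X Y Z W : Type*} : (Y ⊕ W) ⊕ (X ⊕ Z) → Option (W ⊕ Z)
  | .inl (.inr d) => some (.inl d)
  | .inr (.inr c) => some (.inr c)
  | _ => none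

/-- `σ ⊘ τ` plays as `σ` between `A` and `B` and as `τ` between `C` and `D`. -/
def seqMap (A B C D : NegGame.{u}) (σ : Set (List (B.M ⊕ A.M))) (τ : Set (List (D.M ⊕ C.M))) :
    Set (List ((B.M ⊕ D.M) ⊕ (A.M ⊕ C.M))) :=
  {s | s ∈ ((A.seq C).lolli (B.seq D)).plays ∧ s.filterMap fstPart ∈ σ ∧ s.filterMap sndPart ∈ τ}

section Sequoid

variable {A B C D N : NegGame.{u}}

theorem part_length {X Y Z W : Type*} (s : List ((Y ⊕ W) ⊕ (X ⊕ Z))) :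
    s.length = (s.filterMap fstPart).length + (s.filterMap sndPart).length := by
  induction s with
  | nil => rfl
  | cons x s ih =>
    rcases x with (x | x) | (x | x) <;> simp [List.filterMap_cons, fstPart, sndPart, ih] <;> omega

section
variable {X Y Z W : Type*} (s : List ((Y ⊕ W) ⊕ (X ⊕ Z)))

theorem LL : (s.filterMap Sum.getLeft?).filterMap Sum.getLeft? =
    (s.filterMap fstPart).filterMap Sum.getLeft? := by
  rw [filterMap_comp (fun _ => rfl), filterMap_comp (fun _ => rfl)]
  congr 1; funext x; rcases x with (_ | _) | (_ | _) <;> rfl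
theorem LR : (s.filterMap Sum.getLeft?).filterMap Sum.getRight? =
    (s.filterMap sndPart).filterMap Sum.getLeft? := by
  rw [filterMap_comp (fun _ => rfl), filterMap_comp (fun _ => rfl)]
  congr 1; funext x; rcases x with (_ | _) | (_ | _) <;> rfl
theorem RL : (s.filterMap Sum.getRight?).filterMap Sum.getLeft? =
    (s.filterMap fstPart).filterMap Sum.getRight? := by
  rw [filterMap_comp (fun _ => rfl), filterMap_comp (fun _ => rfl)]
  congr 1; funext x; rcases x with (_ | _) | (_ | _) <;> rfl
theorem RR : (s.filterMap Sum.getRight?).filterMap Sum.getRight? =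
    (s.filterMap sndPart).filterMap Sum.getRight? := by
  rw [filterMap_comp (fun _ => rfl), filterMap_comp (fun _ => rfl)]
  congr 1; funext x; rcases x with (_ | _) | (_ | _) <;> rfl

end

/-- In a play on `(A ⊘ C) ⊸ (B ⊘ D)`, Player is never to move in both parts. -/
theorem parts_par {s : List ((B.M ⊕ D.M) ⊕ (A.M ⊕ C.M))}
    (h : s ∈ ((A.seq C).lolli (B.seq D)).plays) (h1 : s.filterMap fstPart ∈ (A.lolli B).plays)
    (h2 : s.filterMap sndPart ∈ (C.lolli D).plays) {t} (ht : t <+: s) :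
    (t.filterMap fstPart).length % 2 + (t.filterMap sndPart).length % 2 ≤ 1 := by
  have e1 := (mem_lolli.1 h1).2.2 _ (ht.filterMap _)
  have e2 := (mem_lolli.1 h2).2.2 _ (ht.filterMap _)
  have hs : s.filterMap Sum.getLeft? ∈ (B.seq D).plays := (mem_lolli.1 h).1
  have e3 := ((mem_seq.1 hs).2.2 _ (ht.filterMap _)).1
  rw [LL, LR] at e3
  rw [length_sum (t.filterMap fstPart), length_sum (t.filterMap sndPart)]
  omega

theorem mem_lolli_seq {s : List ((B.M ⊕ D.M) ⊕ (A.M ⊕ C.M))} :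
    s ∈ ((A.seq C).lolli (B.seq D)).plays ↔
    s.filterMap Sum.getLeft? ∈ (B.seq D).plays ∧ s.filterMap Sum.getRight? ∈ (A.seq C).plays ∧
    ∀ t, t <+: s →
      (t.filterMap Sum.getRight?).length % 2 ≤ (t.filterMap Sum.getLeft?).length % 2 :=
  mem_lolli (A := A.seq C) (B := B.seq D)

theorem lolli_seq_isStrategy {σ : Set (List ((B.M ⊕ D.M) ⊕ (A.M ⊕ C.M)))}
    (h0 : ([] : List ((B.M ⊕ D.M) ⊕ (A.M ⊕ C.M))) ∈ σ)
    (h1 : ∀ s : List ((B.M ⊕ D.M) ⊕ (A.M ⊕ C.M)), s ∈ σ →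
      s ∈ ((A.seq C).lolli (B.seq D)).plays)
    (h2 : ∀ s : List ((B.M ⊕ D.M) ⊕ (A.M ⊕ C.M)), s ∈ σ → s.length % 2 = 0)
    (h3 : ∀ (s : List ((B.M ⊕ D.M) ⊕ (A.M ⊕ C.M))) (a b : (B.M ⊕ D.M) ⊕ (A.M ⊕ C.M)),
      s ++ [a, b] ∈ σ → s ∈ σ)
    (h4 : ∀ (s : List ((B.M ⊕ D.M) ⊕ (A.M ⊕ C.M))) (a b : (B.M ⊕ D.M) ⊕ (A.M ⊕ C.M)),
      s ++ [a] ∈ σ → s ++ [b] ∈ σ → a = b) :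
    IsStrategy ((A.seq C).lolli (B.seq D)).toGame σ :=
  lolli_isStrategy (A := A.seq C) (B := B.seq D) h0 h1 h2 h3 h4

theorem seqMap_isStrategy {σ : Set (List (B.M ⊕ A.M))} {τ : Set (List (D.M ⊕ C.M))}
    (hσ : IsStrategy (A.lolli B).toGame σ) (hτ : IsStrategy (C.lolli D).toGame τ) :
    IsStrategy ((A.seq C).lolli (B.seq D)).toGame (seqMap A B C D σ τ) := by
  have key : ∀ s ∈ seqMap A B C D σ τ, s.length % 2 = 0 := by
    rintro s ⟨_, h2, h3⟩
    have e1 := lolli_even hσ h2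
    have e2 := lolli_even hτ h3
    rw [part_length]; omega
  refine lolli_seq_isStrategy
    ⟨((A.seq C).lolli (B.seq D)).nil_mem, lolli_nil hσ, lolli_nil hτ⟩
    (fun s h => h.1) key ?_ ?_
  · intro s a b h
    have hk : (s ++ [a, b]).length % 2 = 0 := key _ h
    obtain ⟨h1, h2, h3⟩ := h
    have hpre : s <+: s ++ [a, b] := ⟨_, rfl⟩
    have hp := parts_par h1 (lolli_subset hσ h2) (lolli_subset hτ h3) hpre
    have hl := part_length s
    simp at hk
    exact ⟨((A.seq C).lolli (B.seq D)).prefix_closed _ h1 _ hpre,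
      lolli_prefix hσ h2 (hpre.filterMap _) (by omega),
      lolli_prefix hτ h3 (hpre.filterMap _) (by omega)⟩
  · intro s a b h h'
    have hk : (s ++ [a]).length % 2 = 0 := key _ h
    obtain ⟨h1, h2, h3⟩ := h
    obtain ⟨k1, k2, k3⟩ := h'
    have hl := part_length s
    have e1 := lolli_even hσ h2
    have e2 := lolli_even hτ h3
    have f1 := lolli_even hσ k2
    have f2 := lolli_even hτ k3
    simp only [List.length_append, List.length_singleton] at hk
    have d1 : ∀ x y, fstPart a = some x → fstPart b = some y → x = y := by
      intro x y hx hy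
      refine lolli_det hσ h2 k2 (s := s.filterMap fstPart) ?_ ?_ ?_
      · rw [fm_snoc, hx]; exact List.prefix_rfl
      · rw [fm_snoc, hy]; exact List.prefix_rfl
      · rw [fm_snoc, hx] at e1; simp at e1; omega
    have d2 : ∀ x y, sndPart a = some x → sndPart b = some y → x = y := by
      intro x y hx hy
      refine lolli_det hτ h3 k3 (s := s.filterMap sndPart) ?_ ?_ ?_
      · rw [fm_snoc, hx]; exact List.prefix_rfl
      · rw [fm_snoc, hy]; exact List.prefix_rfl
      · rw [fm_snoc, hx] at e2; simp at e2; omega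
    rw [fm_snoc] at e1 e2 f1 f2
    rcases a with (a | a) | (a | a) <;> rcases b with (b | b) | (b | b) <;>
      simp only [fstPart, sndPart, Option.toList, List.append_nil, List.length_append,
        List.length_singleton] at e1 e2 f1 f2 <;> first
      | omega
      | cases d1 _ _ rfl rfl <;> rfl
      | cases d2 _ _ rfl rfl <;> rfl

theorem parts_copy {X Y : Type*} : ∀ (n : ℕ) (t : List ((X ⊕ Y) ⊕ (X ⊕ Y))), t.length ≤ n →
    t.length % 2 = 0 →
    (∀ r, r <+: t → (r.filterMap fstPart).length % 2 + (r.filterMap sndPart).length % 2 ≤ 1) →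
    (∀ r, r <+: t → (r.filterMap fstPart).length % 2 = 0 →
      (r.filterMap fstPart).filterMap Sum.getRight? =
        (r.filterMap fstPart).filterMap Sum.getLeft?) →
    (∀ r, r <+: t → (r.filterMap sndPart).length % 2 = 0 →
      (r.filterMap sndPart).filterMap Sum.getRight? =
        (r.filterMap sndPart).filterMap Sum.getLeft?) →
    t.filterMap Sum.getRight? = t.filterMap Sum.getLeft? := by
  intro n
  induction n with
  | zero =>
    intro t hn _ _ _ _
    rw [List.length_eq_zero_iff.1 (Nat.le_zero.1 hn)]; rfl
  | succ n ih =>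
    intro t hn he hp hf hg
    rcases even_cases he with rfl | ⟨r, x, y, rfl, hr⟩
    · rfl
    have hpre : r <+: r ++ [x, y] := ⟨_, rfl⟩
    have e := ih r (by simp at hn; omega) hr (fun q hq => hp q (hq.trans hpre))
      (fun q hq => hf q (hq.trans hpre)) (fun q hq => hg q (hq.trans hpre))
    have p1 := hp _ List.prefix_rfl
    have p2 := hp _ hpre
    have l1 := part_length (r ++ [x, y])
    have l2 := part_length r
    have a1 := hf _ List.prefix_rfl (by omega)
    have a2 := hg _ List.prefix_rfl (by omega)
    have b1 := hf _ hpre (by omega)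
    have b2 := hg _ hpre (by omega)
    rw [show r ++ [x, y] = r ++ [x] ++ [y] by simp] at a1 a2 ⊢
    simp only [List.filterMap_append, b1] at a1
    simp only [List.filterMap_append, b2] at a2
    simp only [fm_snoc, e]
    rcases x with (x | x) | (x | x) <;> rcases y with (y | y) | (y | y) <;>
      simp [fstPart, sndPart, List.filterMap_cons] at a1 a2 ⊢ <;> simp [*]

theorem eq_cc_seq {s : List ((N.M ⊕ A.M) ⊕ (N.M ⊕ A.M))}
    (h : s ∈ copycat (N.seq A) (N.seq A) id) :
    ∃ t : List (N.M ⊕ A.M), t ∈ (N.seq A).plays ∧ s = cc (N.seq A) t :=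
  ⟨_, (mem_lolli.1 h.1).1, eq_cc _ le_rfl h⟩

theorem seqMap_id : seqMap N N A A (copycat N N id) (copycat A A id) =
    copycat (N.seq A) (N.seq A) id := by
  ext s
  constructor
  · rintro ⟨h1, h2, h3⟩
    have hpar := fun t ht => parts_par (t := t) h1 h2.1 h3.1 ht
    refine ⟨h1, ?_, ?_⟩
    · have := part_length s
      have e1 := h2.2.1
      have e2 := h3.2.1
      change s.length % 2 = 0
      omega
    · intro t ht he
      rw [List.map_id]
      refine parts_copy t.length t le_rfl he (fun r hr => hpar r (hr.trans ht)) ?_ ?_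
      · intro r hr hre
        have := h2.2.2 _ ((hr.trans ht).filterMap _) hre
        rwa [List.map_id] at this
      · intro r hr hre
        have := h3.2.2 _ ((hr.trans ht).filterMap _) hre
        rwa [List.map_id] at this
  · intro h
    obtain ⟨t, hP, h'⟩ := eq_cc_seq h
    have h1 := h.1
    have hs := mem_seq.1 hP
    refine ⟨h1, ?_, ?_⟩
    · convert cc_mem hs.1 using 1
      rw [h', fm_eq_flatMap Sum.getLeft?]
      unfold cc
      rw [List.flatMap_assoc]
      apply fm_flatMap
      rintro (n | a)
      · have : (N.seq A).lab (Sum.inl n) = N.lab n := rfl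
        simp only [Sum.getLeft?_inl, Option.toList, List.flatMap_singleton, cc1, this]
        cases N.lab n <;> rfl
      · have : (N.seq A).lab (Sum.inr a) = A.lab a := rfl
        simp only [cc1, this]
        cases A.lab a <;> rfl
    · convert cc_mem hs.2.1 using 1
      rw [h', fm_eq_flatMap Sum.getRight?]
      unfold cc
      rw [List.flatMap_assoc]
      apply fm_flatMap
      rintro (n | a)
      · have : (N.seq A).lab (Sum.inl n) = N.lab n := rfl
        simp only [cc1, this]
        cases N.lab n <;> rfl
      · have : (N.seq A).lab (Sum.inr a) = A.lab a := rfl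
        simp only [Sum.getRight?_inr, Option.toList, List.flatMap_singleton, cc1, this]
        cases A.lab a <;> rfl

/-- Restrictions of interactions on `(X ⊕ X') + (Y ⊕ Y') + (Z ⊕ Z')`. -/
def interFst {X X' Y Y' Z Z' : Type*} : (X ⊕ X') ⊕ ((Y ⊕ Y') ⊕ (Z ⊕ Z')) → Option (X ⊕ (Y ⊕ Z))
  | .inl (.inl a) => some (.inl a)
  | .inr (.inl (.inl a)) => some (.inr (.inl a))
  | .inr (.inr (.inl a)) => some (.inr (.inr a))
  | _ => none

def interSnd {X X' Y Y' Z Z' : Type*} :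
    (X ⊕ X') ⊕ ((Y ⊕ Y') ⊕ (Z ⊕ Z')) → Option (X' ⊕ (Y' ⊕ Z'))
  | .inl (.inr a) => some (.inl a)
  | .inr (.inl (.inr a)) => some (.inr (.inl a))
  | .inr (.inr (.inr a)) => some (.inr (.inr a))
  | _ => none

theorem six_comm {X X' Y Y' Z Z' V V₁ V₂ : Type*}
    {f : (X ⊕ X') ⊕ ((Y ⊕ Y') ⊕ (Z ⊕ Z')) → Option V₁} {g : V₁ → Option V}
    {f' : (X ⊕ X') ⊕ ((Y ⊕ Y') ⊕ (Z ⊕ Z')) → Option V₂} {g' : V₂ → Option V}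
    (w : List ((X ⊕ X') ⊕ ((Y ⊕ Y') ⊕ (Z ⊕ Z'))))
    (H : ∀ x, (f x).bind g = (f' x).bind g') :
    (w.filterMap f).filterMap g = (w.filterMap f').filterMap g' := by
  rw [List.filterMap_filterMap, List.filterMap_filterMap]
  congr 1; funext x; exact H x

theorem inter_glue {X X' Y Y' Z Z' : Type*} (s : List ((Z ⊕ Z') ⊕ (X ⊕ X')))
    (u : List (X ⊕ (Y ⊕ Z))) (v : List (X' ⊕ (Y' ⊕ Z')))
    (hu : u.filterMap proj13 = s.filterMap fstPart)
    (hv : v.filterMap proj13 = s.filterMap sndPart) :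
    ∃ w : List ((X ⊕ X') ⊕ ((Y ⊕ Y') ⊕ (Z ⊕ Z'))), w.filterMap proj13 = s ∧
      w.filterMap interFst = u ∧ w.filterMap interSnd = v := by
  obtain ⟨w₁, hw₁, hw₁'⟩ := amalgam (X := ((Z ⊕ Z') ⊕ (X ⊕ X')) ⊕ Y') Sum.getLeft?
    (fun x => match x with
      | .inl (.inl (.inr c)) => some (.inr (.inr c))
      | .inl (.inr (.inr a)) => some (.inl a)
      | .inr b => some (.inr (.inl b))
      | _ => none) sndPart proj13
    (by
      rintro ((y | y) | (y | y)) h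
      · exact ⟨.inl (.inl (.inl y)), rfl, rfl⟩
      · cases h
      · exact ⟨.inl (.inr (.inl y)), rfl, rfl⟩
      · cases h)
    (by
      rintro (z | z | z) h
      · cases h
      · exact ⟨.inr z, rfl, rfl⟩
      · cases h)
    (by
      rintro ((y | y) | (y | y)) (z | z | z) k h h' <;> cases h <;> cases h'
      · exact ⟨.inl (.inl (.inr y)), rfl, rfl⟩
      · exact ⟨.inl (.inr (.inr y)), rfl, rfl⟩)
    s v hv.symm
  obtain ⟨w, hw, hw'⟩ := amalgam (X := (X ⊕ X') ⊕ ((Y ⊕ Y') ⊕ (Z ⊕ Z')))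
    (Y := ((Z ⊕ Z') ⊕ (X ⊕ X')) ⊕ Y')
    (fun x => match x with
      | .inl a => some (.inl (.inr a))
      | .inr (.inr c) => some (.inl (.inl c))
      | .inr (.inl (.inr b)) => some (.inr b)
      | .inr (.inl (.inl _)) => none) interFst
    (fun x => match x with
      | .inl y => fstPart y
      | .inr _ => none) proj13
    (by
      rintro (((y | y) | (y | y)) | y) h
      · cases h
      · exact ⟨.inr (.inr (.inr y)), rfl, rfl⟩
      · cases h
      · exact ⟨.inl (.inr y), rfl, rfl⟩
      · exact ⟨.inr (.inl (.inr y)), rfl, rfl⟩)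
    (by
      rintro (z | z | z) h
      · cases h
      · exact ⟨.inr (.inl (.inl z)), rfl, rfl⟩
      · cases h)
    (by
      rintro (((y | y) | (y | y)) | y) (z | z | z) k h h' <;> cases h <;> cases h'
      · exact ⟨.inr (.inr (.inl y)), rfl, rfl⟩
      · exact ⟨.inl (.inl y), rfl, rfl⟩)
    w₁ u (by
      rw [hu, ← hw₁, List.filterMap_filterMap]
      congr 1; funext x; rcases x with x | x <;> rfl)
  refine ⟨w, ?_, hw', ?_⟩
  · rw [← hw₁, ← hw, List.filterMap_filterMap]
    congr 1; funext x; rcases x with (_ | _) | ((_ | _) | (_ | _)) <;> rfl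
  · rw [← hw₁', ← hw, List.filterMap_filterMap]
    congr 1; funext x; rcases x with (_ | _) | ((_ | _) | (_ | _)) <;> rfl

section
variable {X X' Y Y' Z Z' : Type*} (w : List ((X ⊕ X') ⊕ ((Y ⊕ Y') ⊕ (Z ⊕ Z'))))

theorem fst12 : (w.filterMap proj12).filterMap fstPart = (w.filterMap interFst).filterMap proj12 :=
  six_comm w (by rintro ((_ | _) | ((_ | _) | (_ | _))) <;> rfl)
theorem fst23 : (w.filterMap proj23).filterMap fstPart = (w.filterMap interFst).filterMap proj23 :=
  six_comm w (by rintro ((_ | _) | ((_ | _) | (_ | _))) <;> rfl)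
theorem fst13 : (w.filterMap proj13).filterMap fstPart = (w.filterMap interFst).filterMap proj13 :=
  six_comm w (by rintro ((_ | _) | ((_ | _) | (_ | _))) <;> rfl)
theorem snd12 : (w.filterMap proj12).filterMap sndPart = (w.filterMap interSnd).filterMap proj12 :=
  six_comm w (by rintro ((_ | _) | ((_ | _) | (_ | _))) <;> rfl)
theorem snd23 : (w.filterMap proj23).filterMap sndPart = (w.filterMap interSnd).filterMap proj23 :=
  six_comm w (by rintro ((_ | _) | ((_ | _) | (_ | _))) <;> rfl)
theorem snd13 : (w.filterMap proj13).filterMap sndPart = (w.filterMap interSnd).filterMap proj13 :=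
  six_comm w (by rintro ((_ | _) | ((_ | _) | (_ | _))) <;> rfl)
theorem c1L : (w.filterMap comp1).filterMap Sum.getLeft? = (w.filterMap interFst).filterMap comp1 :=
  six_comm w (by rintro ((_ | _) | ((_ | _) | (_ | _))) <;> rfl)
theorem c2L : (w.filterMap comp2).filterMap Sum.getLeft? = (w.filterMap interFst).filterMap comp2 :=
  six_comm w (by rintro ((_ | _) | ((_ | _) | (_ | _))) <;> rfl)
theorem c3L : (w.filterMap comp3).filterMap Sum.getLeft? = (w.filterMap interFst).filterMap comp3 :=
  six_comm w (by rintro ((_ | _) | ((_ | _) | (_ | _))) <;> rfl)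
theorem c1R : (w.filterMap comp1).filterMap Sum.getRight? = (w.filterMap interSnd).filterMap comp1 :=
  six_comm w (by rintro ((_ | _) | ((_ | _) | (_ | _))) <;> rfl)
theorem c2R : (w.filterMap comp2).filterMap Sum.getRight? = (w.filterMap interSnd).filterMap comp2 :=
  six_comm w (by rintro ((_ | _) | ((_ | _) | (_ | _))) <;> rfl)
theorem c3R : (w.filterMap comp3).filterMap Sum.getRight? = (w.filterMap interSnd).filterMap comp3 :=
  six_comm w (by rintro ((_ | _) | ((_ | _) | (_ | _))) <;> rfl)

end

theorem seqMap_comp {σ : Set (List (B.M ⊕ A.M))} {τ : Set (List (C.M ⊕ B.M))}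
    (hσ : IsStrategy (A.lolli B).toGame σ) (hτ : IsStrategy (B.lolli C).toGame τ) :
    seqMap N N A C (copycat N N id) (compSet (X := A.M) (Y := B.M) (Z := C.M) σ τ) =
    compSet (X := N.M ⊕ A.M) (Y := N.M ⊕ B.M) (Z := N.M ⊕ C.M)
      (seqMap N N A B (copycat N N id) σ) (seqMap N N B C (copycat N N id) τ) := by
  have hid : IsStrategy (N.lolli N).toGame (copycat N N id) :=
    copycat_isStrategy Function.injective_id
  ext s
  constructor
  · rintro ⟨h1, h2, v, hv1, hv2, hv3⟩
    rw [← id_compSet hid] at h2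
    obtain ⟨u, hu1, hu2, hu3⟩ := h2
    obtain ⟨w, rfl, rfl, rfl⟩ := inter_glue s u v hu3 hv3
    have pu := inter_par (lolli_subset hid hu1) (lolli_subset hid hu2)
    have pv := inter_par (lolli_subset hσ hv1) (lolli_subset hτ hv2)
    have hl := mem_lolli_seq.1 h1
    have hL : (w.filterMap comp3) ∈ (N.seq C).plays := by
      have := hl.1
      rwa [proj13_L] at this
    have hR : (w.filterMap comp1) ∈ (N.seq A).plays := by
      have := hl.2.1
      rwa [proj13_R] at this
    have sL := (mem_seq.1 hL).2.2
    have sR := (mem_seq.1 hR).2.2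
    have hM : (w.filterMap comp2) ∈ (N.seq B).plays := by
      refine mem_seq.2 ⟨?_, ?_, ?_⟩
      · rw [c2L, ← proj12_L]
        exact (mem_lolli.1 (lolli_subset hid hu1)).1
      · rw [c2R, ← proj12_L]
        exact (mem_lolli.1 (lolli_subset hσ hv1)).1
      · intro t₀ ht₀
        obtain ⟨t, ht, rfl⟩ := prefix_lift ht₀
        rw [c2L, c2R]
        constructor
        · have q1 := pu _ (ht.filterMap _)
          have q2 := pv _ (ht.filterMap _)
          have q3 := (sL _ (ht.filterMap _)).1
          rw [c3L, c3R] at q3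
          unfold Par at q1 q2
          omega
        · intro h
          by_contra hne
          obtain ⟨a, l, hal⟩ := List.exists_cons_of_ne_nil hne
          rw [← c2R] at hal
          obtain ⟨t₁, ht₁, e₁⟩ := prefix_lift (t := [a]) (s := t.filterMap comp2)
            (f := Sum.getRight?) (by rw [hal]; exact ⟨l, rfl⟩)
          obtain ⟨r, hr, rfl⟩ := prefix_lift ht₁
          have hrw := hr.trans ht
          have q1 := pu _ (hrw.filterMap _)
          have q2 := pv _ (hrw.filterMap _)
          have q3 := sL _ (hrw.filterMap _)
          rw [c3L, c3R] at q3
          rw [c2R] at e₁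
          have e2 : (r.filterMap interFst).filterMap comp2 = [] := by
            have := (hr.filterMap interFst).filterMap comp2
            rw [h] at this
            exact List.prefix_nil.1 this
          unfold Par at q1 q2
          rw [e₁] at q2
          simp only [List.length_singleton] at q2
          have e3 := hu2.2.2 ((r.filterMap interFst).filterMap proj23)
            ((hrw.filterMap _).filterMap _) (by rw [len23, e2]; simp; omega)
          rw [proj23_L, proj23_R, e2, List.map_id] at e3
          have e4 := q3.2 e3.symm
          rw [e4] at q2
          simp at q2
    refine ⟨w, ⟨mem_lolli_seq.2 ⟨?_, ?_, ?_⟩, ?_, ?_⟩, ⟨mem_lolli_seq.2 ⟨?_, ?_, ?_⟩, ?_, ?_⟩, rfl⟩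
    · rw [proj12_L]; exact hM
    · rw [proj12_R]; exact hR
    · intro t₀ ht₀
      obtain ⟨t, ht, rfl⟩ := prefix_lift ht₀
      have q1 := pu _ (ht.filterMap _)
      have q2 := pv _ (ht.filterMap _)
      have q3 := (sL _ (ht.filterMap _)).1
      have q4 := (sR _ (ht.filterMap _)).1
      rw [c3L, c3R] at q3
      rw [c1L, c1R] at q4
      unfold Par at q1 q2
      rw [proj12_L, proj12_R, length_sum (t.filterMap comp1), length_sum (t.filterMap comp2),
        c1L, c1R, c2L, c2R]
      omega
    · rw [fst12]; exact hu1
    · rw [snd12]; exact hv1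
    · rw [proj23_L]; exact hL
    · rw [proj23_R]; exact hM
    · intro t₀ ht₀
      obtain ⟨t, ht, rfl⟩ := prefix_lift ht₀
      have q1 := pu _ (ht.filterMap _)
      have q2 := pv _ (ht.filterMap _)
      have q3 := (sL _ (ht.filterMap _)).1
      rw [c3L, c3R] at q3
      unfold Par at q1 q2
      rw [proj23_L, proj23_R, length_sum (t.filterMap comp3), length_sum (t.filterMap comp2),
        c3L, c3R, c2L, c2R]
      omega
    · rw [fst23]; exact hu2
    · rw [snd23]; exact hv2
  · rintro ⟨w, ⟨h1, h2, h3⟩, ⟨k1, k2, k3⟩, rfl⟩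
    refine ⟨comp_plays (A := N.seq A) (B := N.seq B) (C := N.seq C) h1 k1, ?_, ?_⟩
    · rw [← id_compSet hid, fst13]
      rw [fst12] at h2
      rw [fst23] at k2
      exact ⟨_, h2, k2, rfl⟩
    · rw [snd13]
      rw [snd12] at h3
      rw [snd23] at k3
      exact ⟨_, h3, k3, rfl⟩

end Sequoid

/-! ### The category `𝒢`, the functor `N ⊘ _`, and the coalgebra `!N` -/

/-- The category `𝒢`: the objects are the negative games, a map `A ⟶ B` is a strategy on
`A ⊸ B`. -/
instance : Category.{u, u + 1} NegGame.{u} where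
  Hom A B := Strategy (A.lolli B).toGame
  id A := ⟨copycat A A id, copycat_isStrategy Function.injective_id⟩
  comp {A B C} σ τ := ⟨compSet (X := A.M) (Y := B.M) (Z := C.M) σ.traces τ.traces,
    comp_isStrategy σ.isStrategy τ.isStrategy⟩
  id_comp σ := Strategy.ext (id_compSet σ.isStrategy)
  comp_id σ := Strategy.ext (compSet_id σ.isStrategy)
  assoc σ τ υ := Strategy.ext (compSet_assoc σ.traces τ.traces υ.traces)

/-- Maps of `𝒢` are ordered by inclusion of strategies. -/
instance (A B : NegGame.{u}) : PartialOrder (A ⟶ B) :=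
  inferInstanceAs (PartialOrder (Strategy (A.lolli B).toGame))

theorem empty_isStrategy (N : NegGame.{u}) : IsStrategy N.toGame {[]} :=
  isStrategy_of rfl (by rintro s (rfl : s = []); exact N.nil_mem)
    (by rintro s (rfl : s = []); rfl) (by intro s a b h; simp at h)
    (by intro s a b h _; simp at h)

/-- The least map is the empty strategy `{ε}`. -/
instance (A B : NegGame.{u}) : OrderBot (A ⟶ B) where
  bot := ⟨{[]}, empty_isStrategy (A.lolli B)⟩
  bot_le σ := by
    rintro s (rfl : s = [])
    exact lolli_nil σ.isStrategy

/-- The functor `N ⊘ _`, sending `σ` to `id ⊘ σ`. -/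
def sequoidFunctor (N : NegGame.{u}) : NegGame.{u} ⥤ NegGame.{u} where
  obj M := N.seq M
  map {A B} σ := ⟨seqMap N N A B (copycat N N id) σ.traces,
    seqMap_isStrategy (copycat_isStrategy Function.injective_id) σ.isStrategy⟩
  map_id _ := Strategy.ext seqMap_id
  map_comp σ τ := Strategy.ext (seqMap_comp σ.isStrategy τ.isStrategy)

/-- The relabelling of the moves of `N ⊘ !N` as moves of `!N`. -/
def unrollMove {X : Type u} : X ⊕ (X × ℕ) → X × ℕ
  | .inl a => (a, 0)
  | .inr (a, n) => (a, n + 1)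

theorem unrollMove_injective {X : Type u} :
    Function.Injective (unrollMove : X ⊕ (X × ℕ) → X × ℕ) := by
  rintro (a | ⟨a, n⟩) (b | ⟨b, m⟩) h <;> simp [unrollMove] at h ⊢ <;> exact h

/-- The copycat map `α : !N → N ⊘ !N`. -/
def alpha (N : NegGame.{u}) : N.bang ⟶ (sequoidFunctor N).obj N.bang :=
  ⟨copycat N.bang (N.seq N.bang) unrollMove, copycat_isStrategy unrollMove_injective⟩

/-- The coalgebra `(!N, α)` of the functor `N ⊘ _`. -/
def bangCoalgebra (N : NegGame.{u}) : Endofunctor.Coalgebra (sequoidFunctor N) where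
  V := N.bang
  str := alpha N

section Unfolding

universe v w

variable {𝒞 : Type w} [Category.{v} 𝒞]

/-- The iterates of an endofunctor. -/
def iterFunctor (F : 𝒞 ⥤ 𝒞) : ℕ → 𝒞 ⥤ 𝒞
  | 0 => 𝟭 𝒞
  | k + 1 => F ⋙ iterFunctor F k

/-- The finite unfoldings `M ⟶ F^k M` of a coalgebra `σ : M ⟶ F M`: the `0`-th one is the
identity and the `(k + 1)`-st one is the `k`-th one followed by `F^k σ`. -/
def unfolding {F : 𝒞 ⥤ 𝒞} (V : Endofunctor.Coalgebra F) :
    ∀ k : ℕ, V.V ⟶ (iterFunctor F k).obj V.V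
  | 0 => 𝟙 V.V
  | k + 1 => unfolding V k ≫ (iterFunctor F k).map V.str

/-- The same construction for an isomorphism `Z ≅ F Z`, giving isomorphisms `Z ≅ F^k Z`. -/
def unfoldingIso {F : 𝒞 ⥤ 𝒞} {Z : 𝒞} (e : Z ≅ F.obj Z) :
    ∀ k : ℕ, Z ≅ (iterFunctor F k).obj Z
  | 0 => Iso.refl Z
  | k + 1 => unfoldingIso e k ≪≫ (iterFunctor F k).mapIso e

end Unfolding

/-- The approximants `α_k⁻¹ ∘ (id ⊘ _)^k(ε) ∘ σ_k : M ⟶ !N`, where `σ_k` is the `k`-th unfolding of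
the coalgebra `V = (M, σ)` and `e : !N ≅ N ⊘ !N` is an isomorphism with unfoldings `α_k`. -/
def approximant (N : NegGame.{u}) (e : N.bang ≅ (sequoidFunctor N).obj N.bang)
    (V : Endofunctor.Coalgebra (sequoidFunctor N)) (k : ℕ) : V.V ⟶ N.bang :=
  unfolding V k ≫ (iterFunctor (sequoidFunctor N) k).map ⊥ ≫ (unfoldingIso e k).inv

end GameSem

/-! The map `α` is a relabelling in disguise. Shifting copy `n` of `!N` to copy `n + 1` and using
`N` itself as copy `0` is a bijection from the moves of `N ⊘ !N` to those of `!N`, and it identifies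
the plays of the two games (`unroll_plays`). The one point that is not bookkeeping is that, in a
play of `!N`, the moves in the copies of positive index alternate by themselves. This holds because
Player always answers in the copy in which Opponent has just moved (`alternating_filter`). Composing
with a copycat strategy along a bijection that identifies plays merely relabels the other strategy
(`compSet_copycat`, deduced from the identity law), so `α` is invertible, with the copycat strategy
along the inverse bijection as its inverse.

Since `α` is invertible, the coalgebra maps from `σ : M → N ⊘ M` to `α` are the fixpoints of the
operator `Φ f = α⁻¹ ∘ (id ⊘ f) ∘ σ` on maps `M → !N` (`unfoldStep`, `unfoldStep_eq_iff`), and the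
approximant `s_k` is `Φ^k(ε)` (`unfolding_comp`). A sequence lies in `Φ f` when it is the visible
part of an interaction that contains one play of `f` (`mem_unfoldStep`). Hence `Φ` is monotone and
commutes with the union of the chain `Φ^k(ε)`; this union is a strategy and a fixpoint, which gives
existence.

For uniqueness, `Φ` is contracting. If a nonempty play of `Φ f` comes from the play `t` of `f`, then
`t` has fewer moves in `!N`: it accounts only for the copies of positive index, and the first move
in the target is in copy `0`. By induction, a play of a fixpoint `f` with at most `k` moves in `!N`
lies in `Φ^k(ε)` (`mem_iterate`). Conversely `Φ^k(ε) ⊆ Φ^k(f) = f`. So every fixpoint is the least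
upper bound of the same chain (`isLUB_of_fixpoint`), which yields uniqueness and the formula for the
solution at once. -/

namespace GameSem

/-! ### Plays of `!N` and of `N ⊘ !N` -/

section Copies

variable {N : NegGame.{u}}

theorem filterMap_map' {X Y Z : Type*} {f : X → Y} {g : Y → Option Z} {h : X → Option Z}
    (H : ∀ x, g (f x) = h x) (s : List X) : (s.map f).filterMap g = s.filterMap h := by
  rw [List.filterMap_map]
  congr 1
  funext x
  exact H x

theorem map_filterMap_comm {X Y Z W : Type*} {f : X → Y} {g : Y → Option Z} {g' : X → Option W}
    {f' : W → Z} (H : ∀ x, g (f x) = (g' x).map f') (s : List X) :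
    (s.map f).filterMap g = (s.filterMap g').map f' := by
  rw [List.map_filterMap, List.filterMap_map]
  congr 1
  funext x
  exact H x

theorem prefix_map_lift {X Y : Type*} {f : X → Y} {s : List X} {t : List Y}
    (h : t <+: s.map f) : ∃ s', s' <+: s ∧ s'.map f = t := by
  rw [← List.filterMap_eq_map] at h ⊢
  exact prefix_lift h

/-- The number of moves in copy `i` is the number of moves with index `i`. -/
theorem length_filter_copy {X : Type*} (i : ℕ) (s : List (X × ℕ)) :
    (s.filter (fun x => x.2 = i)).length = (s.filterMap (copy i)).length := by
  induction s with
  | nil => rfl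
  | cons x s ih =>
    by_cases h : x.2 = i <;> simp [copy, h] <;> simpa [copy] using ih

theorem filter_snoc_pos {X : Type*} {p : X → Bool} {x : X} (h : p x) (s : List X) :
    (s ++ [x]).filter p = s.filter p ++ [x] := by
  simp [List.filter_append, h]

theorem filter_snoc_neg {X : Type*} {p : X → Bool} {x : X} (h : ¬ p x) (s : List X) :
    (s ++ [x]).filter p = s.filter p := by
  simp [List.filter_append, h]

/-- In an alternating interleaving of plays of `N`, the moves in any set of copies alternate, and
whenever Opponent is to move, he is to move in every set of copies. -/
theorem alternating_filter (p : ℕ → Bool) : ∀ (n : ℕ) (s : List (N.M × ℕ)), s.length ≤ n →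
    Alternating (fun x : N.M × ℕ => N.lab x.1) Player.O s →
    (∀ i, s.filterMap (copy i) ∈ N.plays) →
    Alternating (fun x : N.M × ℕ => N.lab x.1) Player.O (s.filter (fun x => p x.2)) ∧
      (s.length % 2 = 0 → (s.filter (fun x => p x.2)).length % 2 = 0) := by
  intro n
  -- `p` has to vary: the step for an arbitrary set of copies uses the hypothesis for the set
  -- consisting of a single copy.
  induction n generalizing p with
  | zero =>
    intro s hn _ _
    rw [List.length_eq_zero_iff.1 (Nat.le_zero.1 hn)]
    exact ⟨trivial, fun _ => rfl⟩
  | succ n ih =>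
    intro s hn ha hc
    by_cases he : s.length % 2 = 0
    · rcases even_cases he with rfl | ⟨r, y, x, rfl, hr⟩
      · exact ⟨trivial, fun _ => rfl⟩
      have e : r ++ [y, x] = r ++ [y] ++ [x] := by simp
      rw [e] at ha hc hn ⊢
      obtain ⟨ha1, ha2⟩ := (alternating_snoc _ _ _ _).1 ha
      have ha3 := ((alternating_snoc _ _ _ _).1 ha1).1
      have hcr : ∀ i, (r ++ [y]).filterMap (copy i) ∈ N.plays := fun i =>
        N.prefix_closed _ (hc i) _ ((List.prefix_append _ _).filterMap _)
      have hcr' : ∀ i, r.filterMap (copy i) ∈ N.plays := fun i =>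
        N.prefix_closed _ (hcr i) _ ((List.prefix_append _ _).filterMap _)
      simp only [List.length_append, List.length_singleton] at hn
      -- Player answers in the copy in which Opponent has just moved. Otherwise the copy of `x`
      -- holds the same moves after `r ++ [y]` as after `r`, an even number by the induction
      -- hypothesis for this one copy; then `x` would be an O-move of `N`, whereas its odd position
      -- in the whole sequence makes it a P-move.
      have hxy : y.2 = x.2 := by
        by_contra hne
        have h1 := (ih (fun j => decide (j = x.2)) r (by omega) ha3 hcr').2 hr
        rw [length_filter_copy] at h1
        have h2 := hc x.2
        have e1 : copy x.2 x = some x.1 := if_pos rfl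
        have e2 : copy x.2 y = none := if_neg hne
        rw [fm_snoc, fm_snoc, e1, e2] at h2
        have h3 := N.lab_eq (by simpa using h2)
        have h4 : N.lab x.1 = turn Player.O (r ++ [y]).length := ha2
        rw [h3] at h4
        have := turn_inj h4
        simp at this
        omega
      obtain ⟨k1, k2⟩ := ih p (r ++ [y]) (by simp; omega) ha1 hcr
      have k3 := (ih p r (by omega) ha3 hcr').2 hr
      -- As `x` and `y` are in the same copy, the filter keeps both or drops both; either way the
      -- parity and the alternation survive.
      by_cases hx : p x.2
      · have hy : p y.2 := hxy ▸ hx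
        rw [filter_snoc_pos (p := fun x : N.M × ℕ => p x.2) hy] at k1
        rw [filter_snoc_pos (p := fun x : N.M × ℕ => p x.2) hx,
          filter_snoc_pos (p := fun x : N.M × ℕ => p x.2) hy, alternating_snoc]
        refine ⟨⟨k1, ha2.trans (turn_congr ?_)⟩, fun _ => ?_⟩ <;> simp <;> omega
      · have hy : ¬ p y.2 := hxy ▸ hx
        rw [filter_snoc_neg (p := fun x : N.M × ℕ => p x.2) hy] at k1
        rw [filter_snoc_neg (p := fun x : N.M × ℕ => p x.2) hx,
          filter_snoc_neg (p := fun x : N.M × ℕ => p x.2) hy]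
        exact ⟨k1, fun _ => k3⟩
    · rcases nil_or_snoc s with rfl | ⟨r, x, rfl⟩
      · simp at he
      -- Here Opponent moves last. Before this move both `r` and its filtered part have even length,
      -- so the label required at the end of the one is that required at the end of the other.
      have hr : r.length % 2 = 0 := by simp at he; omega
      refine ⟨?_, fun h => absurd h he⟩
      obtain ⟨ha1, ha2⟩ := (alternating_snoc _ _ _ _).1 ha
      obtain ⟨h1, h2⟩ := ih p r (by simp at hn; omega) ha1
        (fun i => N.prefix_closed _ (hc i) _ ((List.prefix_append _ _).filterMap _))
      by_cases hx : p x.2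
      · rw [filter_snoc_pos (p := fun x : N.M × ℕ => p x.2) hx, alternating_snoc]
        exact ⟨h1, ha2.trans (turn_congr (by rw [hr, h2 hr]))⟩
      · rw [filter_snoc_neg (p := fun x : N.M × ℕ => p x.2) hx]
        exact h1

theorem alternating_map {X Y : Type u} (f : X → Y) (l : Y → Player) (s : List X) (b : Player) :
    Alternating l b (s.map f) ↔ Alternating (fun x => l (f x)) b s := by
  induction s generalizing b with
  | nil => rfl
  | cons x s ih => exact and_congr Iff.rfl (ih _)

theorem unroll_copy_zero {X : Type u} (s : List (X ⊕ X × ℕ)) :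
    (s.map unrollMove).filterMap (copy 0) = s.filterMap Sum.getLeft? :=
  filterMap_map' (by rintro (a | ⟨a, n⟩) <;> simp [unrollMove, copy]) s

theorem unroll_copy_succ {X : Type u} (s : List (X ⊕ X × ℕ)) (i : ℕ) :
    (s.map unrollMove).filterMap (copy (i + 1)) =
      (s.filterMap Sum.getRight?).filterMap (copy i) := by
  rw [List.filterMap_filterMap]
  exact filterMap_map' (by rintro (a | ⟨a, n⟩) <;> simp [unrollMove, copy]) s

/-- This puts the restriction to the right component in the form to which `alternating_filter`
applies: it is, up to the shift of indices, the part of the relabelled sequence outside copy `0`. -/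
theorem unroll_filter {X : Type u} (s : List (X ⊕ X × ℕ)) :
    (s.map unrollMove).filter (fun x => decide (0 < x.2)) =
      (s.filterMap Sum.getRight?).map (fun x => (x.1, x.2 + 1)) := by
  induction s with
  | nil => rfl
  | cons x s ih => rcases x with a | ⟨a, n⟩ <;> simpa [unrollMove, List.filterMap_cons] using ih

theorem eq_nil_of_copies {X : Type*} {s : List (X × ℕ)} (h : ∀ i, s.filterMap (copy i) = []) :
    s = [] := by
  cases s with
  | nil => rfl
  | cons x s => simpa [copy] using h x.2

/-- The plays of `N ⊘ !N` are, up to relabelling, those of `!N`. -/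
theorem unroll_plays {s : List (N.M ⊕ N.M × ℕ)} :
    s ∈ (N.seq N.bang).plays ↔ s.map unrollMove ∈ N.bang.plays := by
  refine (seq_iff (N := N) (M := N.bang)).trans ?_
  change Alternating (Sum.elim N.lab N.bang.lab) Player.O s ∧ s.filterMap Sum.getLeft? ∈ N.plays ∧
    s.filterMap Sum.getRight? ∈ N.bangPlays ∧ (∀ t, t <+: s → t.filterMap Sum.getLeft? = [] →
      t.filterMap Sum.getRight? = []) ↔
    Alternating (fun x : N.M × ℕ => N.lab x.1) Player.O (s.map unrollMove) ∧
    (∀ i, (s.map unrollMove).filterMap (copy i) ∈ N.plays) ∧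
    ∀ t, t <+: s.map unrollMove → ∀ i, t.filterMap (copy i) = [] →
      t.filterMap (copy (i + 1)) = []
  -- The relabelling preserves labels, so the alternation of the whole sequence is the same
  -- condition on both sides and can be split off.
  have hlab : (fun x : N.M ⊕ N.M × ℕ => N.lab (unrollMove x).1) =
      Sum.elim N.lab N.bang.lab := by
    funext x; rcases x with _ | _ <;> rfl
  rw [alternating_map, hlab]
  refine and_congr_right fun ha => ?_
  constructor
  · rintro ⟨h1, ⟨_, h2, h3⟩, h4⟩
    refine ⟨?_, ?_⟩
    · rintro (_ | i)
      · rw [unroll_copy_zero]; exact h1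
      · rw [unroll_copy_succ]; exact h2 i
    · intro t₀ ht₀
      obtain ⟨t, ht, rfl⟩ := prefix_map_lift ht₀
      -- For index `0`, the rule on the order in which copies are opened is the rule of the sequoid
      -- that the first move is on the left; for larger indices it is the rule inside the right-hand
      -- `!N`.
      rintro (_ | i) h
      · rw [unroll_copy_zero] at h
        rw [unroll_copy_succ, h4 t ht h]; rfl
      · rw [unroll_copy_succ] at h ⊢
        exact h3 _ (ht.filterMap _) i h
  · rintro ⟨h1, h2⟩
    have e0 := h1 0
    rw [unroll_copy_zero] at e0
    refine ⟨e0, ⟨?_, ?_, ?_⟩, ?_⟩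
    -- That the right component alternates on its own is part of being a play of `!N`, but it is not
    -- among the hypotheses on the relabelled sequence; it comes from filtering by positive index.
    -- The shift of indices does not affect labels.
    · have := (alternating_filter (fun i => decide (0 < i)) _ (s.map unrollMove) le_rfl
        (by rw [alternating_map, hlab]; exact ha) h1).1
      rw [unroll_filter, alternating_map] at this
      exact this
    · intro i
      have := h1 (i + 1)
      rwa [unroll_copy_succ] at this
    · intro t₀ ht₀ i
      obtain ⟨t, ht, rfl⟩ := prefix_lift ht₀
      have := h2 _ (ht.map _) (i + 1)
      rwa [unroll_copy_succ, unroll_copy_succ] at this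
    · intro t ht h
      -- If copy `0` is still unopened, then so are all the others, one after another.
      have hn : ∀ i, (t.map unrollMove).filterMap (copy i) = [] := by
        intro i
        induction i with
        | zero => rw [unroll_copy_zero]; exact h
        | succ i ih => exact h2 _ (ht.map _) i ih
      refine eq_nil_of_copies fun i => ?_
      rw [← unroll_copy_succ]
      exact hn (i + 1)

end Copies

/-! ### Copycat strategies along bijections that identify plays -/

section PlayIso

variable {A B M : NegGame.{u}}

/-- Every condition defining a copycat strategy speaks of restrictions of prefixes. Relabelling the
target by `φ` commutes with both, so it turns the copycat condition along `φ` into the one for the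
identity on `A`. This makes the identity law available for `φ`. -/
theorem copycat_relabel (φ : B.M ≃ A.M) (hφ : ∀ s, s ∈ B.plays ↔ s.map φ ∈ A.plays)
    (s : List (B.M ⊕ A.M)) :
    s ∈ copycat A B φ ↔ s.map (Sum.map φ id) ∈ copycat A A id := by
  have hL : ∀ t : List (B.M ⊕ A.M), (t.map (Sum.map φ id)).filterMap Sum.getLeft? =
      (t.filterMap Sum.getLeft?).map φ :=
    map_filterMap_comm (by rintro (_ | _) <;> rfl)
  have hR : ∀ t : List (B.M ⊕ A.M), (t.map (Sum.map φ id)).filterMap Sum.getRight? =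
      t.filterMap Sum.getRight? :=
    filterMap_map' (by rintro (_ | _) <;> rfl)
  change _ ∧ _ ∧ _ ↔ _ ∧ _ ∧ _
  refine and_congr ?_ (and_congr ?_ ?_)
  · rw [mem_lolli, mem_lolli, hL, hR, ← hφ]
    refine and_congr_right fun _ => and_congr_right fun _ => ⟨fun h t₀ ht₀ => ?_, fun h t ht => ?_⟩
    · obtain ⟨t, ht, rfl⟩ := prefix_map_lift ht₀
      rw [hL, hR, List.length_map]
      exact h t ht
    · have := h _ (ht.map _)
      rwa [hL, hR, List.length_map] at this
  · rw [List.length_map]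
  · refine ⟨fun h t₀ ht₀ he => ?_, fun h t ht he => ?_⟩
    · obtain ⟨t, ht, rfl⟩ := prefix_map_lift ht₀
      rw [List.length_map] at he
      rw [hL, hR, List.map_id]
      exact h t ht he
    · have := h _ (ht.map _) (by rwa [List.length_map])
      rwa [hL, hR, List.map_id] at this

/-- Composition with the copycat strategy along an isomorphism of plays is relabelling. -/
theorem compSet_copycat (φ : B.M ≃ A.M) (hφ : ∀ s, s ∈ B.plays ↔ s.map φ ∈ A.plays)
    {σ : Set (List (A.M ⊕ M.M))} (hσ : IsStrategy (M.lolli A).toGame σ) (s : List (B.M ⊕ M.M)) :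
    s ∈ compSet (X := M.M) (Y := A.M) (Z := B.M) σ (copycat A B φ) ↔
      s.map (Sum.map φ id) ∈ σ := by
  -- With `σ` written as its composite with the identity, both sides speak of interactions of `σ`
  -- with a copycat strategy. Relabelling the third component matches these interactions with each
  -- other and leaves the first two components alone.
  conv_rhs => rw [← compSet_id hσ]
  have h12 : ∀ w : List (M.M ⊕ (A.M ⊕ B.M)),
      (w.map (Sum.map id (Sum.map id φ))).filterMap proj12 = w.filterMap proj12 :=
    filterMap_map' (by rintro (_ | _ | _) <;> rfl)
  have h23 : ∀ w : List (M.M ⊕ (A.M ⊕ B.M)), (w.map (Sum.map id (Sum.map id φ))).filterMap proj23 =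
      (w.filterMap proj23).map (Sum.map φ id) :=
    map_filterMap_comm (by rintro (_ | _ | _) <;> rfl)
  have h13 : ∀ w : List (M.M ⊕ (A.M ⊕ B.M)), (w.map (Sum.map id (Sum.map id φ))).filterMap proj13 =
      (w.filterMap proj13).map (Sum.map φ id) :=
    map_filterMap_comm (by rintro (_ | _ | _) <;> rfl)
  constructor
  · rintro ⟨w, h1, h2, rfl⟩
    refine ⟨w.map (Sum.map id (Sum.map id φ)), ?_, ?_, h13 w⟩
    · rwa [h12]
    · rw [h23]; exact (copycat_relabel φ hφ _).1 h2
  · rintro ⟨w₀, h1, h2, h3⟩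
    -- Surjectivity of `φ` is used here: every interaction on `M`, `A`, `A` arises by relabelling,
    -- namely from its image under `φ.symm`.
    obtain ⟨w, rfl⟩ : ∃ w : List (M.M ⊕ (A.M ⊕ B.M)), w.map (Sum.map id (Sum.map id φ)) = w₀ := by
      refine ⟨w₀.map (Sum.map id (Sum.map id φ.symm)), ?_⟩
      rw [List.map_map]
      convert List.map_id w₀ using 2
      funext x; rcases x with _ | _ | _ <;> simp
    rw [h12] at h1
    rw [h23] at h2
    rw [h13] at h3
    refine ⟨w, h1, (copycat_relabel φ hφ _).2 h2, ?_⟩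
    refine List.map_injective_iff.2 ?_ h3
    exact Sum.map_injective.2 ⟨φ.injective, Function.injective_id⟩

theorem plays_symm {φ : B.M ≃ A.M} (hφ : ∀ s, s ∈ B.plays ↔ s.map φ ∈ A.plays) (s : List A.M) :
    s ∈ A.plays ↔ s.map φ.symm ∈ B.plays := by
  rw [hφ, List.map_map]; simp

theorem relabel_relabel (φ : B.M ≃ A.M) (s : List (A.M ⊕ M.M)) :
    (s.map (Sum.map φ.symm id)).map (Sum.map φ id) = s := by
  rw [List.map_map]
  convert List.map_id s using 2
  funext x; rcases x with _ | _ <;> simp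

/-- The copycat map along a relabelling of moves. -/
def copycatHom (φ : B.M ≃ A.M) : A ⟶ B := ⟨copycat A B φ, copycat_isStrategy φ.injective⟩

theorem mem_comp_copycatHom (φ : B.M ≃ A.M) (hφ : ∀ s, s ∈ B.plays ↔ s.map φ ∈ A.plays)
    (f : M ⟶ A) (s : List (B.M ⊕ M.M)) :
    s ∈ Strategy.traces (f ≫ copycatHom φ) ↔ s.map (Sum.map φ id) ∈ Strategy.traces f :=
  compSet_copycat φ hφ f.isStrategy s

/-- Composing relabels the copycat strategy along `φ` by `φ.symm`, and that strategy is itself the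
identity relabelled by `φ`; the two relabellings cancel. -/
theorem copycatHom_comp_symm (φ : B.M ≃ A.M) (hφ : ∀ s, s ∈ B.plays ↔ s.map φ ∈ A.plays) :
    copycatHom φ ≫ copycatHom φ.symm = 𝟙 A := by
  refine Strategy.ext (Set.ext fun (s : List (A.M ⊕ A.M)) => ?_)
  refine (mem_comp_copycatHom φ.symm (plays_symm hφ) (copycatHom φ) s).trans ?_
  refine (copycat_relabel φ hφ _).trans ?_
  rw [relabel_relabel]
  exact Iff.rfl

/-- A bijection between the moves of two games that identifies their plays is an isomorphism. -/
def copycatIso (φ : B.M ≃ A.M) (hφ : ∀ s, s ∈ B.plays ↔ s.map φ ∈ A.plays) : A ≅ B where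
  hom := copycatHom φ
  inv := copycatHom φ.symm
  hom_inv_id := copycatHom_comp_symm φ hφ
  -- The same law for `φ.symm`, whose inverse is `φ` by definition.
  inv_hom_id := copycatHom_comp_symm φ.symm (plays_symm hφ)

end PlayIso

/-! ### Invertibility of `α` -/

/-- Moving on from copy `i` to copy `i + 1` is a bijection from `N ⊘ !N` to `!N`. -/
noncomputable def unrollEquiv (N : NegGame.{u}) : (N.seq N.bang).M ≃ N.bang.M :=
  -- The forward map stays literally `unrollMove`, which is why `alphaIso_hom` holds by `rfl`.
  Equiv.ofBijective (unrollMove (X := N.M)) ⟨unrollMove_injective, by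
    rintro ⟨a, _ | n⟩
    · exact ⟨.inl a, rfl⟩
    · exact ⟨.inr (a, n), rfl⟩⟩

/-- The isomorphism `!N ≅ N ⊘ !N`. -/
noncomputable def alphaIso (N : NegGame.{u}) : N.bang ≅ (sequoidFunctor N).obj N.bang :=
  copycatIso (unrollEquiv N) fun _ => unroll_plays

theorem alphaIso_hom (N : NegGame.{u}) : (alphaIso N).hom = alpha N := rfl

/-! ### Finite unfoldings as iterates of one operator, in any category -/

section Approximants

universe v w

variable {𝒞 : Type w} [Category.{v} 𝒞] {F : 𝒞 ⥤ 𝒞} {Z : 𝒞}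

/-- One step of unfolding of a map into the carrier of an isomorphism `Z ≅ F Z`. -/
def unfoldStep (e : Z ≅ F.obj Z) (V : Endofunctor.Coalgebra F) (f : V.V ⟶ Z) : V.V ⟶ Z :=
  V.str ≫ F.map f ≫ e.inv

/-- As `F^(k+1)` is `F` followed by `F^k`, the innermost layer `V.str`, `F f`, `e.inv` of the
`(k+1)`-st unfolding lies entirely under `F^k`, where it amounts to replacing `f` by `unfoldStep e V
f`. Hence the induction with `f` arbitrary. For `f = ⊥` the left-hand side is the approximant. -/
theorem unfolding_comp (e : Z ≅ F.obj Z) (V : Endofunctor.Coalgebra F) (k : ℕ) (f : V.V ⟶ Z) :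
    unfolding V k ≫ (iterFunctor F k).map f ≫ (unfoldingIso e k).inv =
      (unfoldStep e V)^[k] f := by
  induction k generalizing f with
  | zero => simp [unfolding, iterFunctor, unfoldingIso]
  | succ k ih =>
    rw [Function.iterate_succ_apply, ← ih]
    simp [unfolding, iterFunctor, unfoldingIso, unfoldStep]

/-- Invertibility of `e` turns the equation for coalgebra maps into a fixpoint equation. -/
theorem unfoldStep_eq_iff (e : Z ≅ F.obj Z) (V : Endofunctor.Coalgebra F) (f : V.V ⟶ Z) :
    unfoldStep e V f = f ↔ V.str ≫ F.map f = f ≫ e.hom := by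
  unfold unfoldStep
  rw [← Category.assoc, Iso.comp_inv_eq]

end Approximants

/-! ### The unfolding operator on strategies and its fixpoints -/

section Fixpoint

variable {N : NegGame.{u}} {V : Endofunctor.Coalgebra (sequoidFunctor N)}

/-- Composition with `α⁻¹` only relabels, so a single interaction `w` of `V.str` with `id ⊘ f`
remains. The strategy `f` enters through one play only, which is the source of both monotonicity and
continuity. -/
theorem mem_unfoldStep (f : V.V ⟶ N.bang) (s : List ((N.M × ℕ) ⊕ V.V.M)) :
    s ∈ Strategy.traces (unfoldStep (alphaIso N) V f) ↔
      ∃ w : List (V.V.M ⊕ ((N.M ⊕ V.V.M) ⊕ (N.M ⊕ N.M × ℕ))),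
        w.filterMap proj12 ∈ Strategy.traces V.str ∧
        w.filterMap proj23 ∈ ((N.seq V.V).lolli (N.seq N.bang)).plays ∧
        (w.filterMap proj23).filterMap fstPart ∈ copycat N N id ∧
        (w.filterMap proj23).filterMap sndPart ∈ Strategy.traces f ∧
        (w.filterMap proj13).map (Sum.map unrollMove id) = s := by
  have h := mem_comp_copycatHom (unrollEquiv N).symm
    (plays_symm (φ := unrollEquiv N) fun _ => unroll_plays)
    (V.str ≫ (sequoidFunctor N).map f) s
  have e : unfoldStep (alphaIso N) V f =
      (V.str ≫ (sequoidFunctor N).map f) ≫ copycatHom (unrollEquiv N).symm :=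
    (Category.assoc _ _ _).symm
  rw [e]
  refine h.trans ⟨?_, ?_⟩
  · rintro ⟨w, h1, ⟨h2, h3, h4⟩, h5⟩
    refine ⟨w, h1, h2, h3, h4, ?_⟩
    exact (congrArg (List.map (Sum.map unrollMove id)) h5).trans
      (relabel_relabel (unrollEquiv N) s)
  · rintro ⟨w, h1, h2, h3, h4, h5⟩
    refine ⟨w, h1, ⟨h2, h3, h4⟩, ?_⟩
    rw [← h5]
    exact (relabel_relabel (unrollEquiv N).symm _).symm

theorem unfoldStep_mono : Monotone (unfoldStep (alphaIso N) V) := by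
  intro f g hfg s hs
  obtain ⟨w, h1, h2, h3, h4, h5⟩ := (mem_unfoldStep f s).1 hs
  exact (mem_unfoldStep g s).2 ⟨w, h1, h2, h3, hfg h4, h5⟩

theorem iterate_mono : Monotone fun k => (unfoldStep (alphaIso N) V)^[k] ⊥ :=
  unfoldStep_mono.monotone_iterate_of_le_map bot_le

/-- A play of a fixpoint with at most `k` moves in the target is a play of the `k`-th iterate. -/
theorem mem_iterate {f : V.V ⟶ N.bang} (hf : unfoldStep (alphaIso N) V f = f) :
    ∀ (k : ℕ) (s : List ((N.M × ℕ) ⊕ V.V.M)), s ∈ Strategy.traces f →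
      (s.filterMap Sum.getLeft?).length ≤ k →
      s ∈ Strategy.traces ((unfoldStep (alphaIso N) V)^[k] ⊥) := by
  -- Plays of `M ⊸ !N` start in the target, so a play without moves there is empty.
  have hnil : ∀ s : List ((N.M × ℕ) ⊕ V.V.M), s ∈ Strategy.traces f →
      s.filterMap Sum.getLeft? = [] → s = [] := by
    intro s hs h0
    have h1 : s.filterMap Sum.getRight? = [] :=
      (lolli_iff.1 (lolli_subset f.isStrategy hs)).2.2.2 s List.prefix_rfl h0
    have h2 := length_sum s
    rw [h0, h1] at h2
    exact List.length_eq_zero_iff.1 h2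
  intro k
  induction k with
  -- Membership in `⊥` is by definition the equation `s = []`.
  | zero => exact fun s hs h0 => hnil s hs (List.length_eq_zero_iff.1 (Nat.le_zero.1 h0))
  | succ k ih =>
    intro s hs hk
    rw [Function.iterate_succ_apply']
    have hs' := hs
    rw [← hf] at hs'
    obtain ⟨w, h1, h2, h3, h4, h5⟩ := (mem_unfoldStep f s).1 hs'
    -- The same interaction serves for the iterate; what remains is that the play of `f` inside it
    -- has at most `k` moves in its target.
    refine (mem_unfoldStep _ s).2 ⟨w, h1, h2, h3, ih _ h4 ?_, h5⟩
    have e1 : s.filterMap Sum.getLeft? =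
        ((w.filterMap proj23).filterMap Sum.getLeft?).map unrollMove := by
      rw [← h5, proj23_L, ← proj13_L]
      exact map_filterMap_comm (by rintro (_ | _) <;> rfl) _
    have hL : ((w.filterMap proj23).filterMap Sum.getLeft?) ∈ (N.seq N.bang).plays :=
      (mem_lolli_seq.1 h2).1
    have h6 := (seq_iff.1 hL).2.2.2 _ List.prefix_rfl
    have h7 := length_sum ((w.filterMap proj23).filterMap Sum.getLeft?)
    rw [← LR]
    rw [e1, List.length_map] at hk
    -- The moves of `s` in `!N` are those of `w` in `N ⊘ !N`, and the play of `f` sees only the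
    -- right component of the latter. If the left component is empty, so is the right one; otherwise
    -- at least one of the at most `k + 1` moves is lost.
    by_cases h0 : ((w.filterMap proj23).filterMap Sum.getLeft?).filterMap Sum.getLeft? = []
    · have h8 : ((w.filterMap proj23).filterMap Sum.getLeft?).filterMap Sum.getRight? = [] := h6 h0
      rw [h8]
      exact Nat.zero_le _
    · have := List.length_pos_iff.2 h0
      omega

/-- The union of the chain of the iterates. -/
def unfoldLimit (V : Endofunctor.Coalgebra (sequoidFunctor N)) : V.V ⟶ N.bang where
  traces := ⋃ k, Strategy.traces ((unfoldStep (alphaIso N) V)^[k] ⊥)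
  isStrategy := by
    let c := fun k => (unfoldStep (alphaIso N) V)^[k] ⊥
    refine isStrategy_of (N := V.V.lolli N.bang) (Set.mem_iUnion.2 ⟨0, rfl⟩) ?_ ?_ ?_ ?_
    · intro s hs
      obtain ⟨k, hk⟩ := Set.mem_iUnion.1 hs
      exact (c k).isStrategy.subset hk
    · intro s hs
      obtain ⟨k, hk⟩ := Set.mem_iUnion.1 hs
      exact (c k).isStrategy.even (N := V.V.lolli N.bang) hk
    · intro s a b hs
      obtain ⟨k, hk⟩ := Set.mem_iUnion.1 hs
      exact Set.mem_iUnion.2 ⟨k, (c k).isStrategy.even_closed s a b hk⟩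
    · intro s a b ha hb
      obtain ⟨k, hk⟩ := Set.mem_iUnion.1 ha
      obtain ⟨l, hl⟩ := Set.mem_iUnion.1 hb
      -- Two plays of the union lie in a common iterate, where determinacy is known.
      exact (c (max k l)).isStrategy.det s a b (iterate_mono (le_max_left k l) hk)
        (iterate_mono (le_max_right k l) hl)

/-- The single play of the union that is used by a play of the step already lies in some `k`-th
iterate, so the result lies in the `(k+1)`-st. Conversely the `k`-th iterate is below the
`(k+1)`-st, hence below the step applied to the union. -/
theorem unfoldStep_unfoldLimit :
    unfoldStep (alphaIso N) V (unfoldLimit V) = unfoldLimit V := by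
  refine Strategy.ext (Set.ext fun (s : List ((N.M × ℕ) ⊕ V.V.M)) => ⟨fun h => ?_, fun h => ?_⟩)
  · obtain ⟨w, h1, h2, h3, h4, h5⟩ := (mem_unfoldStep _ s).1 h
    obtain ⟨k, hk⟩ := Set.mem_iUnion.1 h4
    refine Set.mem_iUnion.2 ⟨k + 1, ?_⟩
    rw [Function.iterate_succ_apply']
    exact (mem_unfoldStep _ s).2 ⟨w, h1, h2, h3, hk, h5⟩
  · obtain ⟨k, hk⟩ := Set.mem_iUnion.1 h
    have h1 : (unfoldStep (alphaIso N) V)^[k] ⊥ ≤ unfoldStep (alphaIso N) V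
        ((unfoldStep (alphaIso N) V)^[k] ⊥) := by
      rw [← Function.iterate_succ_apply' (unfoldStep (alphaIso N) V)]
      exact iterate_mono k.le_succ
    exact unfoldStep_mono (fun _ ht => Set.mem_iUnion.2 ⟨k, ht⟩) (h1 hk)

/-- A fixpoint of the unfolding is the least upper bound of the iterates. -/
theorem isLUB_of_fixpoint {f : V.V ⟶ N.bang} (hf : unfoldStep (alphaIso N) V f = f) :
    IsLUB (Set.range fun k => (unfoldStep (alphaIso N) V)^[k] ⊥) f := by
  constructor
  · rintro _ ⟨k, rfl⟩
    -- Iterating on `⊥ ≤ f` leaves the fixpoint `f` on the right.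
    have := (unfoldStep_mono.iterate k) (bot_le : ⊥ ≤ f)
    rwa [Function.iterate_fixed hf] at this
  · intro g hg s hs
    -- The index of the iterate is the number of moves of `s` in the target.
    exact hg ⟨_, rfl⟩ (mem_iterate hf _ s hs le_rfl)

end Fixpoint

/-! ### Finality -/

/-- `(!N, α)` is a final coalgebra. -/
noncomputable def bangIsTerminal (N : NegGame.{u}) : Limits.IsTerminal (bangCoalgebra N) :=
  Limits.IsTerminal.ofUniqueHom
    (fun V => ⟨unfoldLimit V, (unfoldStep_eq_iff (alphaIso N) V _).1 unfoldStep_unfoldLimit⟩)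
    fun V g => Endofunctor.Coalgebra.Hom.ext <|
      -- Any coalgebra map and the constructed one are least upper bounds of the same chain.
      (isLUB_of_fixpoint ((unfoldStep_eq_iff (alphaIso N) V g.f).2 g.h)).unique
        (isLUB_of_fixpoint unfoldStep_unfoldLimit)

end GameSem

/-- The witness `e` expresses that `α` is invertible, and it is determined by `e.hom`. Finality is
data, hence also given by a witness; as maps into a final object are unique, the map `h.from V` does
not depend on the choice of `h`. -/
theorem mainTheorem4 (N : GameSem.NegGame.{u}) :
    ∃ (e : N.bang ≅ (GameSem.sequoidFunctor N).obj N.bang)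
      (h : Limits.IsTerminal (GameSem.bangCoalgebra N)),
      e.hom = GameSem.alpha N ∧
      ∀ V : Endofunctor.Coalgebra (GameSem.sequoidFunctor N),
        Monotone (GameSem.approximant N e V) ∧
        IsLUB (Set.range (GameSem.approximant N e V)) (h.from V).f := by
  refine ⟨GameSem.alphaIso N, GameSem.bangIsTerminal N, GameSem.alphaIso_hom N, fun V => ?_⟩
  have h : GameSem.approximant N (GameSem.alphaIso N) V =
      fun k => (GameSem.unfoldStep (GameSem.alphaIso N) V)^[k] ⊥ :=
    funext fun k => GameSem.unfolding_comp (GameSem.alphaIso N) V k ⊥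
  rw [h]
  exact ⟨GameSem.iterate_mono, GameSem.isLUB_of_fixpoint
    ((GameSem.unfoldStep_eq_iff (GameSem.alphaIso N) V _).2
      ((GameSem.bangIsTerminal N).from V).h)⟩
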